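/- **Conventions.** Let $R$ be a commutative ring with unit. A *weighted digraph* $(G,w)$ over $R$ consists of a finite set $V$ of vertices, a set $E\subseteq V\times V$ of directed edges without loops $(i,i)$, and a function $w:V\to R$. A *morphism* $f:(G,w)\to(G',w')$ is a map $f:V\to V'$ with $w(i)=w'(f(i))$ for all $i\in V$, such that for every edge $i\to j$ of $G$ either $f(i)\to f(j)$ is an edge of $G'$ or $f(i)=f(j)$. For $p\ge -1$ let $\Lambda_p(V)$ be the free $R$-module on the elementary $p$-paths $e_{i_0\cdots i_p}$, $i_0,\dots,i_p\in V$ (so $\Lambda_{-1}(V)=R$, spanned by the empty path). Put $$\partial^w e_{i_0\cdots i_p}=\sum_{k=0}^p(-1)^k\,w(i_k)\,e_{i_0\cdots\widehat{i_k}\cdots i_p}.$$ A path $e_{i_0\cdots i_p}$ is *regular* if $i_k\ne i_{k+1}$ for all $k$. Let $\mathcal R_p(V)$ be the span of the regular elementary $p$-paths, identified with $\Lambda_p(V)$ modulo the span of the non-regular ones. The operator $\partial^w$ descends to $\partial^w:\mathcal R_p(V)\to\mathcal R_{p-1}(V)$ with $\partial^w\circ\partial^w=0$. Let $\mathcal A_p(G)\subseteq\mathcal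 R_p(V)$ be the span of the $e_{i_0\cdots i_p}$ with $i_{k-1}\to i_k$ an edge for $1\le k\le p$; in particular $\mathcal A_{-1}(G)=R$. Put $$\Omega^w_p(G)=\{v\in\mathcal A_p(G):\partial^w v\in\mathcal A_{p-1}(G)\},$$ with $\mathcal A_p(G)=\Omega_p^w(G)=0$ for $p<-1$. Let $H_p(G,w;R)$, $p\in\mathbb Z$, be the $p$-th homology of the augmented complex $$\cdots\to\Omega^w_1(G)\to\Omega^w_0(G)\to\Omega^w_{-1}(G)=R\to 0.$$ In particular $H_p=0$ for $p<-1$. A morphism $f$ induces maps on homology through $e_{i_0\cdots i_p}\mapsto e_{f(i_0)\cdots f(i_p)}$, where non-regular paths are set to $0$. The *join* $(G*G',w*w')$ of $(G,w)$ and $(G',w')$ (with vertex sets made disjoint) has vertex set $V\sqcup V'$, edge set $E\sqcup E'\sqcup(V\times V')$, and the weight which is $w$ on $V$ and $w'$ on $V'$. It is a functor of the pair. **Theorem.** Let $R$ be a principal ideal domain. For each integer $r\ge 0$ and all weighted digraphs $(G,w)$, $(G',w')$ over $R$ there is a short exact sequence $$0\to\bigoplus_{\substack{p,q\ge-1\\p+q=r-1}}H_p(G,w;R)\otimes_R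 H_q(G',w';R)\to H_r(G*G',w*w';R)\to\bigoplus_{\substack{p,q\ge-1\\p+q=r-1}}\operatorname{Tor}^R_1\big(H_p(G,w;R),H_{q-1}(G',w';R)\big)\to 0,$$ natural with respect to morphisms of weighted digraphs in both $(G,w)$ and $(G',w')$, and for each pair $(G,w)$, $(G',w')$ the sequence splits. -/

import Mathlib

open CategoryTheory MonoidalCategory

universe u

namespace WPath

noncomputable section

/-! ### Paths on a set

An elementary `p`-path `e_{i₀ … i_p}` on `V` is a list of `p + 1` elements of `V`; the empty list is
the elementary `(-1)`-path `e`. The module `List V →₀ R` is the direct sum over `p ≥ -1` of the free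
modules `Λ_p(V)` on the elementary `p`-paths. -/

section Paths

variable {R : Type u} [CommRing R] {V V' V'' : Type u}

/-- The elementary path given by a list of vertices, as a basis element of `Λ(V)`. -/
abbrev elem (R : Type u) [CommRing R] {V : Type u} (l : List V) : List V →₀ R :=
  Finsupp.single l 1

/-- The weighted boundary `e_{i₀ … i_p} ↦ ∑ k, (-1)^k w(i_k) e_{i₀ … î_k … i_p}` on `Λ(V)`. -/
def boundary (w : V → R) : (List V →₀ R) →ₗ[R] (List V →₀ R) :=
  Finsupp.linearCombination R fun l : List V =>
    ∑ k : Fin l.length, ((-1) ^ (k : ℕ) * w (l.get k)) • elem R (l.eraseIdx k)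

open scoped Classical in
/-- The projection of `Λ(V)` onto the span of the regular elementary paths (those without two equal
consecutive vertices), with kernel the span of the non-regular ones. It identifies the quotient of
`Λ(V)` by the non-regular paths with the span of the regular paths. -/
def regProj (R : Type u) [CommRing R] (V : Type u) : (List V →₀ R) →ₗ[R] (List V →₀ R) :=
  Finsupp.linearCombination R fun l : List V => if l.IsChain (· ≠ ·) then elem R l else 0

/-- The weighted boundary on regular paths: the weighted boundary modulo non-regular paths. -/
def regBoundary (w : V → R) : (List V →₀ R) →ₗ[R] (List V →₀ R) :=
  regProj R V ∘ₗ boundary w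

/-- The map `e_{i₀ … i_p} ↦ e_{f(i₀) … f(i_p)}` on `Λ(V)`. -/
def listMap (R : Type u) [CommRing R] (f : V → V') : (List V →₀ R) →ₗ[R] (List V' →₀ R) :=
  Finsupp.lmapDomain R R (List.map f)

/-- The map induced by `f` on regular paths: `listMap` modulo non-regular paths. -/
def push (R : Type u) [CommRing R] (f : V → V') : (List V →₀ R) →ₗ[R] (List V' →₀ R) :=
  regProj R V' ∘ₗ listMap R f

/-- Prepending a vertex. -/
def consMap (R : Type u) [CommRing R] (i : V) : (List V →₀ R) →ₗ[R] (List V →₀ R) :=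
  Finsupp.lmapDomain R R (List.cons i)

theorem consMap_elem (i : V) (l : List V) : consMap R i (elem R l) = elem R (i :: l) := by
  simp [consMap, elem]

theorem listMap_elem (f : V → V') (l : List V) :
    listMap R f (elem R l) = elem R (l.map f) := by
  simp [listMap, elem]

theorem regProj_elem_of (l : List V) (h : l.IsChain (· ≠ ·)) :
    regProj R V (elem R l) = elem R l := by
  simp [regProj, elem, h]

theorem regProj_elem_of_not (l : List V) (h : ¬ l.IsChain (· ≠ ·)) :
    regProj R V (elem R l) = 0 := by
  simp [regProj, elem, h]

theorem boundary_nil (w : V → R) : boundary w (elem R []) = 0 := by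
  simp [boundary, elem]

theorem boundary_cons (w : V → R) (i : V) (l : List V) :
    boundary w (elem R (i :: l)) = w i • elem R l - consMap R i (boundary w (elem R l)) := by
  have hb : ∀ l : List V, boundary w (elem R l) =
      ∑ k : Fin l.length, ((-1) ^ (k : ℕ) * w (l.get k)) • elem R (l.eraseIdx k) := fun l => by
    simp only [boundary, elem, Finsupp.linearCombination_single, one_smul]
  rw [hb, hb, map_sum, sub_eq_add_neg, ← Finset.sum_neg_distrib]
  refine (Fin.sum_univ_succ (n := l.length) _).trans ?_
  congr 1
  · simp
  · refine Finset.sum_congr rfl fun k _ => ?_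
    rw [map_smul, consMap_elem, ← neg_smul]
    congr 1
    simp [pow_succ]

theorem boundary_consMap (w : V → R) (i : V) (x : List V →₀ R) :
    boundary w (consMap R i x) = w i • x - consMap R i (boundary w x) := by
  suffices h : boundary w ∘ₗ consMap R i =
      w i • LinearMap.id - consMap R i ∘ₗ boundary w from LinearMap.congr_fun h x
  refine Finsupp.lhom_ext' fun l => LinearMap.ext_ring ?_
  simpa [consMap_elem] using boundary_cons (R := R) w i l

theorem boundary_boundary (w : V → R) (x : List V →₀ R) : boundary w (boundary w x) = 0 := by
  suffices h : boundary w ∘ₗ boundary w = 0 from LinearMap.congr_fun h x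
  refine Finsupp.lhom_ext' fun l => LinearMap.ext_ring ?_
  change boundary w (boundary w (elem R l)) = 0
  induction l with
  | nil => simp [boundary_nil]
  | cons i l ih =>
    rw [boundary_cons, map_sub, map_smul, boundary_consMap, ih, map_zero, sub_zero, sub_self]

theorem regProj_consMap (i : V) (x : List V →₀ R) :
    regProj R V (consMap R i (regProj R V x)) = regProj R V (consMap R i x) := by
  suffices h : regProj R V ∘ₗ consMap R i ∘ₗ regProj R V = regProj R V ∘ₗ consMap R i from
    LinearMap.congr_fun h x
  refine Finsupp.lhom_ext' fun l => LinearMap.ext_ring ?_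
  change regProj R V (consMap R i (regProj R V (elem R l))) = regProj R V (consMap R i (elem R l))
  by_cases hl : l.IsChain (· ≠ ·)
  · rw [regProj_elem_of l hl]
  · rw [regProj_elem_of_not l hl, consMap_elem, regProj_elem_of_not, map_zero, map_zero]
    exact fun h => hl h.of_cons

theorem regProj_consMap_consMap (i : V) (x : List V →₀ R) :
    regProj R V (consMap R i (consMap R i x)) = 0 := by
  suffices h : regProj R V ∘ₗ consMap R i ∘ₗ consMap R i = 0 from LinearMap.congr_fun h x
  refine Finsupp.lhom_ext' fun l => LinearMap.ext_ring ?_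
  change regProj R V (consMap R i (consMap R i (elem R l))) = 0
  rw [consMap_elem, consMap_elem, regProj_elem_of_not]
  simp

theorem regProj_boundary_of_not (w : V → R) (l : List V) (h : ¬ l.IsChain (· ≠ ·)) :
    regProj R V (boundary w (elem R l)) = 0 := by
  induction l with
  | nil => simp at h
  | cons i l ih =>
    by_cases hl : l.IsChain (· ≠ ·)
    · cases l with
      | nil => simp at h
      | cons j l =>
        have hij : i = j := by
          by_contra hne
          exact h (List.isChain_cons_cons.2 ⟨hne, hl⟩)
        subst hij
        rw [boundary_cons, boundary_cons, map_sub (consMap R i), map_smul (consMap R i),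
          consMap_elem, sub_sub_cancel, regProj_consMap_consMap]
    · rw [boundary_cons, map_sub, map_smul, regProj_elem_of_not l hl, ← regProj_consMap, ih hl]
      simp

theorem regProj_boundary_regProj (w : V → R) (x : List V →₀ R) :
    regProj R V (boundary w (regProj R V x)) = regProj R V (boundary w x) := by
  suffices h : regProj R V ∘ₗ boundary w ∘ₗ regProj R V = regProj R V ∘ₗ boundary w from
    LinearMap.congr_fun h x
  refine Finsupp.lhom_ext' fun l => LinearMap.ext_ring ?_
  change regProj R V (boundary w (regProj R V (elem R l))) = regProj R V (boundary w (elem R l))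
  by_cases hl : l.IsChain (· ≠ ·)
  · rw [regProj_elem_of l hl]
  · rw [regProj_elem_of_not l hl, regProj_boundary_of_not w l hl, map_zero, map_zero]

theorem regBoundary_regBoundary (w : V → R) (x : List V →₀ R) :
    regBoundary w (regBoundary w x) = 0 := by
  simp [regBoundary, regProj_boundary_regProj, boundary_boundary]

theorem listMap_boundary (w : V → R) (w' : V' → R) (f : V → V') (hf : ∀ i, w i = w' (f i))
    (x : List V →₀ R) : boundary w' (listMap R f x) = listMap R f (boundary w x) := by
  have hc : ∀ (i : V) (y : List V →₀ R),
      listMap R f (consMap R i y) = consMap R (f i) (listMap R f y) := by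
    intro i y
    suffices h : listMap R f ∘ₗ consMap R i = consMap R (f i) ∘ₗ listMap R f from
      LinearMap.congr_fun h y
    refine Finsupp.lhom_ext' fun l => LinearMap.ext_ring ?_
    change listMap R f (consMap R i (elem R l)) = consMap R (f i) (listMap R f (elem R l))
    simp only [consMap_elem, listMap_elem, List.map_cons]
  suffices h : boundary w' ∘ₗ listMap R f = listMap R f ∘ₗ boundary w from LinearMap.congr_fun h x
  refine Finsupp.lhom_ext' fun l => LinearMap.ext_ring ?_
  change boundary w' (listMap R f (elem R l)) = listMap R f (boundary w (elem R l))
  induction l with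
  | nil => simp only [listMap_elem, boundary_nil, List.map_nil, map_zero]
  | cons i l ih =>
    rw [listMap_elem, List.map_cons, boundary_cons, boundary_cons, map_sub, map_smul, hc, ← ih,
      listMap_elem, hf]

theorem push_regProj (f : V → V') (x : List V →₀ R) :
    push R f (regProj R V x) = push R f x := by
  suffices h : push R f ∘ₗ regProj R V = push R f from LinearMap.congr_fun h x
  refine Finsupp.lhom_ext' fun l => LinearMap.ext_ring ?_
  change regProj R V' (listMap R f (regProj R V (elem R l))) =
    regProj R V' (listMap R f (elem R l))
  by_cases hl : l.IsChain (· ≠ ·)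
  · rw [regProj_elem_of l hl]
  · rw [regProj_elem_of_not l hl, listMap_elem, regProj_elem_of_not, map_zero, map_zero]
    intro h
    exact hl (((List.isChain_map f).1 h).imp fun a b hab e => hab (congrArg f e))

theorem regBoundary_push (w : V → R) (w' : V' → R) (f : V → V') (hf : ∀ i, w i = w' (f i))
    (x : List V →₀ R) : regBoundary w' (push R f x) = push R f (regBoundary w x) := by
  change regProj R V' (boundary w' (regProj R V' (listMap R f x))) =
    push R f (regProj R V (boundary w x))
  rw [regProj_boundary_regProj, listMap_boundary w w' f hf, push_regProj]
  rfl

theorem push_push (f : V → V') (g : V' → V'') (x : List V →₀ R) :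
    push R g (push R f x) = push R (g ∘ f) x := by
  change push R g (regProj R V' (listMap R f x)) = _
  rw [push_regProj]
  simp only [push, listMap, LinearMap.comp_apply, Finsupp.lmapDomain_apply,
    ← Finsupp.mapDomain_comp]
  congr 2
  funext l
  simp

end Paths

/-! ### Weighted digraphs -/

/-- A weighted digraph over `R`: a finite digraph without loops, with a weight in `R` on each
vertex. -/
structure WeightedDigraph (R : Type u) where
  /-- The vertices. -/
  V : Type u
  [finite : Finite V]
  /-- The directed edges. -/
  graph : Digraph V
  loopless : ∀ i, ¬ graph.Adj i i
  /-- The weight function. -/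
  weight : V → R

/-- A morphism of weighted digraphs: a map on the vertices which preserves weights and sends every
directed edge to a directed edge or to a single vertex. -/
@[ext]
structure WeightedDigraph.Hom {R : Type u} (G G' : WeightedDigraph R) where
  /-- The map on vertices. -/
  toFun : G.V → G'.V
  map_adj : ∀ i j, G.graph.Adj i j → G'.graph.Adj (toFun i) (toFun j) ∨ toFun i = toFun j
  map_weight : ∀ i, G.weight i = G'.weight (toFun i)

instance (R : Type u) : Category (WeightedDigraph R) where
  Hom := WeightedDigraph.Hom
  id G := ⟨id, fun _ _ h => Or.inl h, fun _ => rfl⟩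
  comp f g := ⟨g.toFun ∘ f.toFun, fun i j h => by
      rcases f.map_adj i j h with h | h
      · exact g.map_adj _ _ h
      · exact Or.inr (congrArg g.toFun h),
    fun i => (f.map_weight i).trans (g.map_weight _)⟩

/-- The edges of the join: those of both digraphs, and all edges from the first to the second. -/
def joinAdj {V V' : Type u} (G : Digraph V) (G' : Digraph V') : V ⊕ V' → V ⊕ V' → Prop
  | Sum.inl i, Sum.inl j => G.Adj i j
  | Sum.inr i, Sum.inr j => G'.Adj i j
  | Sum.inl _, Sum.inr _ => True
  | Sum.inr _, Sum.inl _ => False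

/-- The join `(G * G', w * w')` of two weighted digraphs, on the disjoint union of their vertex
sets. -/
def join {R : Type u} (G G' : WeightedDigraph R) : WeightedDigraph R where
  V := G.V ⊕ G'.V
  finite := by
    have := G.finite
    have := G'.finite
    infer_instance
  graph := ⟨joinAdj G.graph G'.graph⟩
  loopless i := by
    cases i with
    | inl i => exact G.loopless i
    | inr i => exact G'.loopless i
  weight := Sum.elim G.weight G'.weight

/-- The join as a functor of two variables. -/
def joinFunctor (R : Type u) : WeightedDigraph R × WeightedDigraph R ⥤ WeightedDigraph R where
  obj P := join P.1 P.2
  map {P Q} φ :=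
    { toFun := Sum.map φ.1.toFun φ.2.toFun
      map_adj := by
        rintro (i | i) (j | j) h
        · exact (φ.1.map_adj i j h).imp_right (congrArg Sum.inl)
        · exact Or.inl trivial
        · exact h.elim
        · exact (φ.2.map_adj i j h).imp_right (congrArg Sum.inr)
      map_weight := by
        rintro (i | i)
        · exact φ.1.map_weight i
        · exact φ.2.map_weight i }
  map_id P := WeightedDigraph.Hom.ext Sum.map_id_id
  map_comp f g := WeightedDigraph.Hom.ext
    (Sum.map_comp_map g.1.toFun g.2.toFun f.1.toFun f.2.toFun).symm

/-! ### The complex of invariant paths and its homology -/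

section Omega

variable {R : Type u} [CommRing R]

/-- `𝒜_p(G)`: the span of the allowed elementary `p`-paths. It is `R` for `p = -1` and `0` for
`p < -1`. -/
def allowed (G : WeightedDigraph R) (p : ℤ) : Submodule R (List G.V →₀ R) :=
  Finsupp.supported R R {l | (l.length : ℤ) = p + 1 ∧ l.IsChain G.graph.Adj}

/-- `Ω_p^w(G)`: the `p`-paths `v ∈ 𝒜_p(G)` with `∂^w v ∈ 𝒜_{p-1}(G)`. -/
def omega (G : WeightedDigraph R) (p : ℤ) : Submodule R (List G.V →₀ R) :=
  allowed G p ⊓ (allowed G (p - 1)).comap (regBoundary G.weight)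

theorem mem_omega (G : WeightedDigraph R) (p : ℤ) (v : List G.V →₀ R) :
    v ∈ omega G p ↔ v ∈ allowed G p ∧ regBoundary G.weight v ∈ allowed G (p - 1) := by
  rw [omega, Submodule.mem_inf, Submodule.mem_comap]

theorem regBoundary_mem_omega (G : WeightedDigraph R) {p q : ℤ} (h : q + 1 = p)
    (v : List G.V →₀ R) (hv : v ∈ omega G p) : regBoundary G.weight v ∈ omega G q := by
  rw [mem_omega] at hv ⊢
  rw [regBoundary_regBoundary]
  have hq : q = p - 1 := eq_sub_of_add_eq h
  rw [hq]
  exact ⟨hv.2, Submodule.zero_mem _⟩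

theorem push_mem_allowed {G G' : WeightedDigraph R} (f : G ⟶ G') {p : ℤ} (v : List G.V →₀ R)
    (hv : v ∈ allowed G p) : push R f.toFun v ∈ allowed G' p := by
  suffices h : allowed G p ≤ (allowed G' p).comap (push R f.toFun) from h hv
  rw [allowed, Finsupp.supported_eq_span_single, Submodule.span_le]
  rintro _ ⟨l, ⟨hl, hc⟩, rfl⟩
  change regProj R G'.V (listMap R f.toFun (elem R l)) ∈ allowed G' p
  rw [listMap_elem]
  by_cases hr : (l.map f.toFun).IsChain (· ≠ ·)
  · rw [regProj_elem_of _ hr]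
    refine Finsupp.single_mem_supported R _ ⟨by simpa using hl, ?_⟩
    rw [List.isChain_map] at hr ⊢
    clear hl
    induction l with
    | nil => exact List.isChain_nil
    | cons i l ih =>
      cases l with
      | nil => exact List.isChain_singleton _
      | cons j l =>
        rw [List.isChain_cons_cons] at hr hc ⊢
        exact ⟨(f.map_adj i j hc.1).resolve_right hr.1, ih hc.2 hr.2⟩
  · rw [regProj_elem_of_not _ hr]
    exact Submodule.zero_mem _

theorem push_mem_omega {G G' : WeightedDigraph R} (f : G ⟶ G') {p : ℤ} (v : List G.V →₀ R)
    (hv : v ∈ omega G p) : push R f.toFun v ∈ omega G' p := by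
  rw [mem_omega] at hv ⊢
  rw [regBoundary_push G.weight G'.weight _ f.map_weight]
  exact ⟨push_mem_allowed f v hv.1, push_mem_allowed f _ hv.2⟩

theorem regProj_of_mem_allowed (G : WeightedDigraph R) {p : ℤ} (v : List G.V →₀ R)
    (hv : v ∈ allowed G p) : regProj R G.V v = v := by
  suffices h : allowed G p ≤ LinearMap.eqLocus (regProj R G.V) LinearMap.id from h hv
  rw [allowed, Finsupp.supported_eq_span_single, Submodule.span_le]
  rintro _ ⟨l, ⟨-, hc⟩, rfl⟩
  exact regProj_elem_of l (hc.imp fun a b hab e => G.loopless a (by rwa [← e] at hab))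

/-- The augmented complex `⋯ → Ω_p^w(G) → ⋯ → Ω_0^w(G) → R → 0`, with `R` in degree `-1`. -/
def omegaComplex (G : WeightedDigraph R) : ChainComplex (ModuleCat.{u} R) ℤ where
  X p := ModuleCat.of R (omega G p)
  d p q :=
    if h : q + 1 = p then
      ModuleCat.ofHom ((regBoundary G.weight).restrict (regBoundary_mem_omega G h))
    else 0
  shape p q h := dif_neg h
  d_comp_d' p q r hpq hqr := by
    rw [dif_pos (show q + 1 = p from hpq), dif_pos (show r + 1 = q from hqr)]
    refine ModuleCat.hom_ext (LinearMap.ext fun v => Subtype.ext ?_)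
    exact regBoundary_regBoundary G.weight v.1

/-- The augmented complex as a functor. -/
def omegaFunctor (R : Type u) [CommRing R] :
    WeightedDigraph R ⥤ ChainComplex (ModuleCat.{u} R) ℤ where
  obj G := omegaComplex G
  map {G G'} f :=
    { f := fun p => ModuleCat.ofHom ((push R f.toFun).restrict (push_mem_omega f))
      comm' := by
        intro p q h
        simp only [omegaComplex]
        rw [dif_pos (show q + 1 = p from h), dif_pos (show q + 1 = p from h)]
        refine ModuleCat.hom_ext (LinearMap.ext fun v => Subtype.ext ?_)
        exact regBoundary_push G.weight G'.weight _ f.map_weight v.1 }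
  map_id G := by
    ext p v
    refine Subtype.ext ?_
    change regProj R G.V (Finsupp.mapDomain (List.map id) v.1) = v.1
    rw [List.map_id_fun, Finsupp.mapDomain_id]
    exact regProj_of_mem_allowed G v.1 ((mem_omega G p v.1).1 v.2).1
  map_comp f g := by
    ext p v
    exact Subtype.ext (push_push f.toFun g.toFun v.1).symm

/-- The weighted path homology `H_p(G, w; R)`, `p ∈ ℤ`, of the augmented complex. -/
def H (R : Type u) [CommRing R] (p : ℤ) : WeightedDigraph R ⥤ ModuleCat.{u} R :=
  omegaFunctor R ⋙ HomologicalComplex.homologyFunctor (ModuleCat.{u} R) (ComplexShape.down ℤ) p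

end Omega

/-! ### The terms of the sequence -/

section Terms

/-- The direct sum of a family of functors to modules. -/
def directSumFunctor {R : Type u} [CommRing R] {C : Type*} [Category* C] {ι : Type}
    [DecidableEq ι] (F : ι → C ⥤ ModuleCat.{u} R) : C ⥤ ModuleCat.{u} R where
  obj X := ModuleCat.of R (DirectSum ι fun i => (F i).obj X)
  map f := ModuleCat.ofHom (DirectSum.lmap fun i => ((F i).map f).hom)
  map_id X := by
    ext1
    refine DirectSum.linearMap_ext _ fun i => LinearMap.ext fun a => ?_
    simp
  map_comp f g := by
    ext1
    refine DirectSum.linearMap_ext _ fun i => LinearMap.ext fun a => ?_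
    simp

variable (R : Type u) [CommRing R] (r : ℤ)

/-- The pairs `(p, q)` of integers with `p, q ≥ -1` and `p + q = r - 1`. -/
abbrev Idx : Type := {x : ℤ × ℤ // -1 ≤ x.1 ∧ -1 ≤ x.2 ∧ x.1 + x.2 = r - 1}

/-- The functor `(G, G') ↦ ⨁_{p + q = r - 1} H_p(G) ⊗ H_q(G')`. -/
def tensorTerm : WeightedDigraph R × WeightedDigraph R ⥤ ModuleCat.{u} R :=
  directSumFunctor fun x : Idx r =>
    (H R x.1.1).prod (H R x.1.2) ⋙ MonoidalCategory.tensor (ModuleCat.{u} R)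

/-- The functor `(G, G') ↦ ⨁_{p + q = r - 1} Tor₁(H_p(G), H_{q-1}(G'))`. -/
def torTerm : WeightedDigraph R × WeightedDigraph R ⥤ ModuleCat.{u} R :=
  directSumFunctor fun x : Idx r =>
    (H R x.1.1).prod (H R (x.1.2 - 1)) ⋙ Functor.uncurry.obj (Tor (ModuleCat.{u} R) 1)

/-- The functor `(G, G') ↦ H_r(G * G')`. -/
def joinTerm : WeightedDigraph R × WeightedDigraph R ⥤ ModuleCat.{u} R :=
  joinFunctor R ⋙ H R r

end Terms

end

end WPath

/-! In the join every vertex of `G` points to every vertex of `G'` and no edge runs back, so the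
allowed paths of `G * G'` are exactly the concatenations of an allowed path of `G` with one of `G'`.
A `p`-path and a `q`-path concatenate to a `(p + q + 1)`-path, and the weighted boundary satisfies a
Leibniz rule (`boundary_catMap`) whose sign counts the vertices of the first path.

Concatenation therefore identifies `Ω_r(G * G')` with the direct sum of the `Ω_p(G) ⊗ Ω_q(G')` over
`p + q = r - 1` (`joinTensor`). The substance is that nothing else is invariant
(`splitMap_mem_range`). In the boundary of an allowed path, a forbidden first half can only come
from differentiating the first half, and likewise for the second. So invariance splits into one
condition per factor. Since each `Ω` is the kernel of a linear map, flatness identifies the common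
kernel with the tensor product.

What remains is the Künneth theorem for complexes of finitely generated torsion-free, hence free,
modules over a principal ideal domain. The resolution `0 → B → Z → H → 0` of the homology of the
second complex `D` exhibits `Tor₁(H_p(C), H_q(D))` as the kernel of `H_p(C) ⊗ B_q → H_p(C) ⊗ Z_q`;
`torEmb` embeds it in (chains of `C` modulo boundaries) `⊗ B_q`. The map from homology to `Tor₁`
sends a cycle to its component of bidegree `(p, q + 1)`, read modulo boundaries on the left and
differentiated on the right. No choice enters, so the map is natural. Exactness is
`exists_sum_cross_eq` and `exists_torPart_eq`. The splitting uses chosen retractions of chains onto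
cycles (`exists_retraction_cross`). -/

namespace WPath

noncomputable section

/-! ### Computing `Tor₁` from a two-term resolution -/

section TwoTerm

open Limits

variable {R : Type u} [CommRing R]

/-- The objects of the complex `⋯ → 0 → B → Z`. -/
def twoTermX (B Z : ModuleCat.{u} R) : ℕ → ModuleCat.{u} R
  | 0 => Z
  | 1 => B
  | _ + 2 => ModuleCat.of R PUnit

/-- The differentials of the complex `⋯ → 0 → B → Z`. -/
def twoTermD {B Z : ModuleCat.{u} R} (f : B ⟶ Z) : ∀ n, twoTermX B Z (n + 1) ⟶ twoTermX B Z n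
  | 0 => f
  | _ + 1 => 0

/-- The complex `⋯ → 0 → B → Z` given by a morphism `f : B ⟶ Z`. -/
def twoTerm {B Z : ModuleCat.{u} R} (f : B ⟶ Z) : ChainComplex (ModuleCat.{u} R) ℕ :=
  ChainComplex.of (twoTermX B Z) (twoTermD f) fun _ => zero_comp

theorem twoTerm_d_one {B Z : ModuleCat.{u} R} (f : B ⟶ Z) : (twoTerm f).d 1 0 = f :=
  ChainComplex.of_d (twoTermX B Z) (twoTermD f) 0

theorem twoTerm_d_succ {B Z : ModuleCat.{u} R} (f : B ⟶ Z) (n : ℕ) :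
    (twoTerm f).d (n + 2) (n + 1) = 0 :=
  ChainComplex.of_d (twoTermX B Z) (twoTermD f) (n + 1)

theorem twoTerm_exactAt_succ {B Z : ModuleCat.{u} R} (f : B ⟶ Z) (hf : Function.Injective f)
    (n : ℕ) : (twoTerm f).ExactAt (n + 1) := by
  rw [HomologicalComplex.exactAt_iff' _ (n + 1 + 1) (n + 1) n (by simp) (by simp),
    ShortComplex.moduleCat_exact_iff]
  intro x hx
  refine ⟨0, (map_zero _).trans ?_⟩
  cases n with
  | zero =>
    refine (hf (Eq.trans ?_ (map_zero f.hom).symm)).symm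
    refine Eq.trans ?_ hx
    exact (congrArg (fun g : B ⟶ Z => g x) (twoTerm_d_one f)).symm
  | succ n => exact Subsingleton.elim (α := PUnit) _ _

/-- The projective resolution given by a short exact sequence `0 → B → Z → N → 0` with `B` and `Z`
projective. -/
def twoTermResolution {B Z N : ModuleCat.{u} R} (f : B ⟶ Z) (g : Z ⟶ N)
    (hB : Projective B) (hZ : Projective Z)
    (hf : Function.Injective f) (hg : Function.Surjective g) (hfg : Function.Exact f g) :
    ProjectiveResolution N where
  complex := twoTerm f
  projective
    | 0 => hZ
    | 1 => hB
    | n + 2 => IsZero.projective (ModuleCat.isZero_of_iff_subsingleton.2 inferInstance)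
  π := (ChainComplex.toSingle₀Equiv _ _).symm ⟨g, by
    rw [twoTerm_d_one]
    exact ModuleCat.hom_ext (LinearMap.ext hfg.apply_apply_eq_zero)⟩
  quasiIso := ⟨fun n => by
    cases n with
    | zero =>
      rw [ChainComplex.quasiIsoAt₀_iff, ShortComplex.quasiIso_iff_of_zeros' _ rfl rfl rfl]
      constructor
      · rw [ShortComplex.moduleCat_exact_iff]
        intro x hx
        obtain ⟨y, hy⟩ := (hfg x).1 hx
        exact ⟨y, (congrArg (fun h : B ⟶ Z => h y) (twoTerm_d_one f)).trans hy⟩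
      · rw [ModuleCat.epi_iff_surjective]
        exact hg
    | succ n =>
      rw [quasiIsoAt_iff_exactAt' (hL := ChainComplex.exactAt_succ_single_obj ..)]
      exact twoTerm_exactAt_succ f hf n⟩

/-- The morphism of two-term complexes given by a commutative square. -/
def twoTermMap {B Z B' Z' : ModuleCat.{u} R} {f : B ⟶ Z} {f' : B' ⟶ Z'} (b : B ⟶ B') (z : Z ⟶ Z')
    (h : b ≫ f' = f ≫ z) : twoTerm f ⟶ twoTerm f' :=
  ChainComplex.ofHom
    (fun
      | 0 => z
      | 1 => b
      | _ + 2 => 0)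
    (fun
      | 0 => (congrArg (fun d : B' ⟶ Z' => b ≫ d) (twoTerm_d_one f')).trans
          (h.trans (congrArg (fun d : B ⟶ Z => d ≫ z) (twoTerm_d_one f)).symm)
      | n + 1 => (congrArg (fun d => _ ≫ d) (twoTerm_d_succ f' n)).trans
          (comp_zero.trans (zero_comp.symm.trans
            (congrArg (fun d => d ≫ _) (twoTerm_d_succ f n)).symm)))

/-- The first homology of a complex whose second differential vanishes, as a submodule of the first
chain module. -/
def homologyIncl (K : ChainComplex (ModuleCat.{u} R) ℕ) (h : K.d 2 1 = 0) :
    K.homology 1 ⟶ K.X 1 :=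
  (K.isoHomologyπ 2 1 (by simp) h).inv ≫ K.iCycles 1

theorem homologyπ_homologyIncl (K : ChainComplex (ModuleCat.{u} R) ℕ) (h : K.d 2 1 = 0) :
    K.homologyπ 1 ≫ homologyIncl K h = K.iCycles 1 :=
  HomologicalComplex.isoHomologyπ_hom_inv_id_assoc ..

instance (K : ChainComplex (ModuleCat.{u} R) ℕ) (h : K.d 2 1 = 0) : Mono (homologyIncl K h) :=
  mono_comp _ _

theorem homologyIncl_comp (K : ChainComplex (ModuleCat.{u} R) ℕ) (h : K.d 2 1 = 0) :
    homologyIncl K h ≫ K.d 1 0 = 0 := by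
  rw [← cancel_epi (K.homologyπ 1), ← Category.assoc, homologyπ_homologyIncl,
    HomologicalComplex.iCycles_d, comp_zero]

theorem exists_homologyIncl_eq (K : ChainComplex (ModuleCat.{u} R) ℕ) (h : K.d 2 1 = 0)
    (y : K.X 1) (hy : K.d 1 0 y = 0) : ∃ t, homologyIncl K h t = y := by
  -- Lifting to cycles is available for morphisms, so the element `y` is encoded as the map `R ⟶ K.X
  -- 1` with `1 ↦ y`.
  let k : ModuleCat.of R R ⟶ K.X 1 := ModuleCat.ofHom (LinearMap.toSpanSingleton R _ y)
  have hk : k ≫ K.d 1 0 = 0 := ModuleCat.hom_ext (LinearMap.ext_ring (by simpa [k] using hy))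
  refine ⟨K.homologyπ 1 (K.liftCycles k 0 (by simp) hk (1 : R)), ?_⟩
  rw [← ModuleCat.comp_apply, homologyπ_homologyIncl, ← ModuleCat.comp_apply,
    HomologicalComplex.liftCycles_i]
  exact one_smul R y

theorem homologyIncl_naturality {K K' : ChainComplex (ModuleCat.{u} R) ℕ} (φ : K ⟶ K')
    (h : K.d 2 1 = 0) (h' : K'.d 2 1 = 0) :
    HomologicalComplex.homologyMap φ 1 ≫ homologyIncl K' h' = homologyIncl K h ≫ φ.f 1 := by
  rw [← cancel_epi (K.homologyπ 1), HomologicalComplex.homologyπ_naturality_assoc,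
    homologyπ_homologyIncl, ← Category.assoc, homologyπ_homologyIncl]
  exact HomologicalComplex.cyclesMap_i φ 1

/-! ### First left derived functors as submodules of a chain module. -/

section LeftDerived

variable (F : ModuleCat.{u} R ⥤ ModuleCat.{u} R) [F.Additive] {N N' : ModuleCat.{u} R}

/-- `F` applied to a projective resolution. -/
abbrev mapResolution (P : ProjectiveResolution N) : ChainComplex (ModuleCat.{u} R) ℕ :=
  (F.mapHomologicalComplex (ComplexShape.down ℕ)).obj P.complex

/-- The first left derived functor, computed by a projective resolution. -/
def leftDerivedIso (P : ProjectiveResolution N) :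
    (F.leftDerived 1).obj N ≅ (mapResolution F P).homology 1 :=
  P.isoLeftDerivedObj F 1

/-- The inclusion of the first left derived functor into the first chain module, for a projective
resolution whose second differential is annihilated by `F`. -/
def leftDerivedIncl (P : ProjectiveResolution N) (h : (mapResolution F P).d 2 1 = 0) :
    (F.leftDerived 1).obj N ⟶ (mapResolution F P).X 1 :=
  (leftDerivedIso F P).hom ≫ homologyIncl _ h

theorem leftDerivedIncl_injective (P : ProjectiveResolution N)
    (h : (mapResolution F P).d 2 1 = 0) : Function.Injective (leftDerivedIncl F P h) :=
  (ModuleCat.mono_iff_injective _).1 (mono_comp _ _)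

theorem leftDerivedIncl_comp (P : ProjectiveResolution N) (h : (mapResolution F P).d 2 1 = 0) :
    leftDerivedIncl F P h ≫ (mapResolution F P).d 1 0 = 0 := by
  rw [leftDerivedIncl, Category.assoc, homologyIncl_comp, comp_zero]

theorem exists_leftDerivedIncl_eq (P : ProjectiveResolution N) (h : (mapResolution F P).d 2 1 = 0)
    (y : (mapResolution F P).X 1) (hy : (mapResolution F P).d 1 0 y = 0) :
    ∃ t, leftDerivedIncl F P h t = y := by
  obtain ⟨t, ht⟩ := exists_homologyIncl_eq _ h y hy
  refine ⟨(leftDerivedIso F P).inv t, ?_⟩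
  rw [leftDerivedIncl, ← ModuleCat.comp_apply, Iso.inv_hom_id_assoc, ht]

theorem leftDerivedIncl_naturality_right (P : ProjectiveResolution N) (Q : ProjectiveResolution N')
    (n : N ⟶ N') (φ : P.complex ⟶ Q.complex) (comm : φ.f 0 ≫ Q.π.f 0 = P.π.f 0 ≫ n)
    (hP : (mapResolution F P).d 2 1 = 0) (hQ : (mapResolution F Q).d 2 1 = 0) :
    (F.leftDerived 1).map n ≫ leftDerivedIncl F Q hQ = leftDerivedIncl F P hP ≫ F.map (φ.f 1) := by
  have h : (F.leftDerived 1).map n ≫ (leftDerivedIso F Q).hom = (leftDerivedIso F P).hom ≫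
      HomologicalComplex.homologyMap ((F.mapHomologicalComplex _).map φ) 1 :=
    ProjectiveResolution.isoLeftDerivedObj_hom_naturality n P Q φ comm F 1
  rw [leftDerivedIncl, leftDerivedIncl, ← Category.assoc, h, Category.assoc,
    homologyIncl_naturality _ hP hQ]
  exact (Category.assoc _ _ _).symm

theorem leftDerivedIncl_naturality_left {G : ModuleCat.{u} R ⥤ ModuleCat.{u} R} [G.Additive]
    (m : F ⟶ G) (P : ProjectiveResolution N)
    (hF : (mapResolution F P).d 2 1 = 0) (hG : (mapResolution G P).d 2 1 = 0) :
    (NatTrans.leftDerived m 1).app N ≫ leftDerivedIncl G P hG =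
      leftDerivedIncl F P hF ≫ m.app (P.complex.X 1) := by
  have h : (NatTrans.leftDerived m 1).app N = (leftDerivedIso F P).hom ≫
      HomologicalComplex.homologyMap ((NatTrans.mapHomologicalComplex m _).app P.complex) 1 ≫
        (leftDerivedIso G P).inv :=
    P.leftDerived_app_eq m 1
  rw [leftDerivedIncl, leftDerivedIncl, h, Category.assoc, Category.assoc,
    Iso.inv_hom_id_assoc, homologyIncl_naturality _ hF hG]
  exact (Category.assoc _ _ _).symm

end LeftDerived

/-- A short exact sequence `0 → B → Z → N → 0` with `B` and `Z` projective. -/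
structure Presentation (B Z N : ModuleCat.{u} R) where
  /-- The inclusion. -/
  f : B ⟶ Z
  /-- The projection. -/
  g : Z ⟶ N
  projective_left : Projective B
  projective_right : Projective Z
  injective : Function.Injective f
  surjective : Function.Surjective g
  exact : Function.Exact f g

namespace Presentation

variable {B Z N : ModuleCat.{u} R} (S : Presentation B Z N)

/-- The projective resolution given by a presentation. -/
def resolution : ProjectiveResolution N :=
  twoTermResolution S.f S.g S.projective_left S.projective_right S.injective S.surjective S.exact

theorem tensor_d_two (M : ModuleCat.{u} R) :
    (mapResolution ((tensoringLeft (ModuleCat.{u} R)).obj M) S.resolution).d 2 1 = 0 :=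
  (congrArg (((tensoringLeft (ModuleCat.{u} R)).obj M).map) (twoTerm_d_succ S.f 0)).trans
    (Functor.map_zero _ _ _)

theorem tensor_d_one (M : ModuleCat.{u} R) :
    (mapResolution ((tensoringLeft (ModuleCat.{u} R)).obj M) S.resolution).d 1 0 = M ◁ S.f :=
  congrArg (((tensoringLeft (ModuleCat.{u} R)).obj M).map) (twoTerm_d_one S.f)

/-- The inclusion of `Tor₁(M, N)` into `M ⊗ B`. -/
def torIncl (M : ModuleCat.{u} R) :
    ((Tor (ModuleCat.{u} R) 1).obj M).obj N ⟶ M ⊗ B :=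
  leftDerivedIncl _ S.resolution (S.tensor_d_two M)

theorem torIncl_injective (M : ModuleCat.{u} R) : Function.Injective (S.torIncl M) :=
  leftDerivedIncl_injective _ S.resolution (S.tensor_d_two M)

theorem torIncl_comp (M : ModuleCat.{u} R) : S.torIncl M ≫ M ◁ S.f = 0 :=
  (congrArg (fun d : (M ⊗ B : ModuleCat.{u} R) ⟶ M ⊗ Z => S.torIncl M ≫ d)
    (S.tensor_d_one M)).symm.trans (leftDerivedIncl_comp _ S.resolution (S.tensor_d_two M))

theorem exists_torIncl_eq (M : ModuleCat.{u} R) (y : (M ⊗ B : ModuleCat.{u} R))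
    (hy : (M ◁ S.f) y = 0) : ∃ t, S.torIncl M t = y :=
  exists_leftDerivedIncl_eq _ S.resolution (S.tensor_d_two M) y
    ((congrArg (fun d : (M ⊗ B : ModuleCat.{u} R) ⟶ M ⊗ Z => d y) (S.tensor_d_one M)).trans hy)

/-- `Tor` derives `M ⊗ -` in its second argument. A map in the first argument is thus a natural
transformation between the derived functors, evaluated on one fixed resolution. -/
theorem torIncl_naturality_left {M M' : ModuleCat.{u} R} (m : M ⟶ M') :
    ((Tor (ModuleCat.{u} R) 1).map m).app N ≫ S.torIncl M' = S.torIncl M ≫ m ▷ B :=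
  leftDerivedIncl_naturality_left _ ((tensoringLeft (ModuleCat.{u} R)).map m) S.resolution
    (S.tensor_d_two M) (S.tensor_d_two M')

/-- The pair `b`, `z` is a lift of `n` to the two-term resolutions, and any lift computes the
derived map. -/
theorem torIncl_naturality_right {B' Z' N' : ModuleCat.{u} R} (S' : Presentation B' Z' N')
    (M : ModuleCat.{u} R) (b : B ⟶ B') (z : Z ⟶ Z') (n : N ⟶ N')
    (hf : b ≫ S'.f = S.f ≫ z) (hg : z ≫ S'.g = S.g ≫ n) :
    ((Tor (ModuleCat.{u} R) 1).obj M).map n ≫ S'.torIncl M = S.torIncl M ≫ M ◁ b :=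
  leftDerivedIncl_naturality_right _ S.resolution S'.resolution n (twoTermMap b z hf) hg
    (S.tensor_d_two M) (S'.tensor_d_two M)

end Presentation

end TwoTerm

/-! ### Linear algebra -/

section LinearAlgebra

open TensorProduct

variable {R : Type u} [CommRing R] {A A' A'' B B' C M : Type*} [AddCommGroup A] [Module R A]
  [AddCommGroup A'] [Module R A'] [AddCommGroup A''] [Module R A'']
  [AddCommGroup B] [Module R B] [AddCommGroup B'] [Module R B'] [AddCommGroup C] [Module R C]
  [AddCommGroup M] [Module R M]

/-- The linear map induced by `h` on the target of a surjection `g`. -/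
def descend (g : A →ₗ[R] B) (hg : Function.Surjective g) (h : A →ₗ[R] C)
    (hk : ∀ a, g a = 0 → h a = 0) : B →ₗ[R] C :=
  (LinearMap.ker g).liftQ h hk ∘ₗ (g.quotKerEquivOfSurjective hg).symm.toLinearMap

theorem descend_apply (g : A →ₗ[R] B) (hg : Function.Surjective g) (h : A →ₗ[R] C)
    (hk : ∀ a, g a = 0 → h a = 0) (a : A) : descend g hg h hk (g a) = h a := by
  have : (g.quotKerEquivOfSurjective hg).symm (g a) = (LinearMap.ker g).mkQ a := by
    rw [LinearEquiv.symm_apply_eq]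
    rfl
  rw [descend, LinearMap.comp_apply, LinearEquiv.coe_coe, this]
  rfl

/-- The factorization of `f` through an injection whose range contains that of `f`. -/
def liftRange (i : A →ₗ[R] B) (hi : Function.Injective i) (f : C →ₗ[R] B)
    (hf : ∀ c, f c ∈ LinearMap.range i) : C →ₗ[R] A :=
  (LinearEquiv.ofInjective i hi).symm.toLinearMap ∘ₗ f.codRestrict _ hf

theorem liftRange_apply (i : A →ₗ[R] B) (hi : Function.Injective i) (f : C →ₗ[R] B)
    (hf : ∀ c, f c ∈ LinearMap.range i) (c : C) : i (liftRange i hi f hf c) = f c := by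
  have := LinearEquiv.apply_symm_apply (LinearEquiv.ofInjective i hi) (f.codRestrict _ hf c)
  exact congrArg Subtype.val this

theorem map_id_injective [Module.Flat R M] {f : A →ₗ[R] B} (hf : Function.Injective f) :
    Function.Injective (TensorProduct.map f (LinearMap.id : M →ₗ[R] M)) :=
  Module.Flat.rTensor_preserves_injective_linearMap f hf

theorem id_map_injective [Module.Flat R M] {f : A →ₗ[R] B} (hf : Function.Injective f) :
    Function.Injective (TensorProduct.map (LinearMap.id : M →ₗ[R] M) f) :=
  Module.Flat.lTensor_preserves_injective_linearMap f hf

/-- A split injection survives tensoring with a module `M` that need not be flat; below, `M` is a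
quotient of chains by boundaries, which may have torsion. -/
theorem id_map_injective_of_retraction {f : A →ₗ[R] B} {s : B →ₗ[R] A}
    (hs : s ∘ₗ f = LinearMap.id) :
    Function.Injective (TensorProduct.map (LinearMap.id : M →ₗ[R] M) f) := by
  refine Function.LeftInverse.injective (g := TensorProduct.map LinearMap.id s) fun x => ?_
  rw [TensorProduct.map_map, hs, LinearMap.id_comp, TensorProduct.map_id, LinearMap.id_apply]

theorem map_id_exact_of_flat [Module.Flat R M] {f : A →ₗ[R] A'} {g : A' →ₗ[R] A''}
    (h : Function.Exact f g) :
    Function.Exact (TensorProduct.map f (LinearMap.id : M →ₗ[R] M))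
      (TensorProduct.map g (LinearMap.id : M →ₗ[R] M)) :=
  Module.Flat.rTensor_exact M h

theorem id_map_exact_of_flat [Module.Flat R M] {f : A →ₗ[R] A'} {g : A' →ₗ[R] A''}
    (h : Function.Exact f g) :
    Function.Exact (TensorProduct.map (LinearMap.id : M →ₗ[R] M) f)
      (TensorProduct.map (LinearMap.id : M →ₗ[R] M) g) :=
  Module.Flat.lTensor_exact M h

theorem map_id_exact {f : A →ₗ[R] A'} {g : A' →ₗ[R] A''} (h : Function.Exact f g)
    (hg : Function.Surjective g) :
    Function.Exact (TensorProduct.map f (LinearMap.id : M →ₗ[R] M))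
      (TensorProduct.map g (LinearMap.id : M →ₗ[R] M)) :=
  rTensor_exact M h hg

theorem map_map_comm (f : A →ₗ[R] A') (g : B →ₗ[R] B') (x : A ⊗[R] B) :
    TensorProduct.map f (LinearMap.id : B' →ₗ[R] B')
        (TensorProduct.map (LinearMap.id : A →ₗ[R] A) g x) =
      TensorProduct.map (LinearMap.id : A' →ₗ[R] A') g
        (TensorProduct.map f (LinearMap.id : B →ₗ[R] B) x) := by
  rw [TensorProduct.map_map, TensorProduct.map_map]
  rfl

end LinearAlgebra

/-! ### Cycles, boundaries and homology of a complex of modules -/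

section Complexes

open HomologicalComplex

variable {R : Type u} [CommRing R]

/-- An integral chain complex of `R`-modules. -/
abbrev Cx (R : Type u) [CommRing R] := ChainComplex (ModuleCat.{u} R) ℤ

variable (K L : Cx R)

/-- The differential as a linear map. -/
abbrev dLin (p q : ℤ) : K.X p →ₗ[R] K.X q := (K.d p q).hom

/-- The inclusion of the cycles as a linear map. -/
abbrev iCyc (p : ℤ) : K.cycles p →ₗ[R] K.X p := (K.iCycles p).hom

/-- The projection from cycles to homology as a linear map. -/
abbrev πHom (p : ℤ) : K.cycles p →ₗ[R] K.homology p := (K.homologyπ p).hom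

/-- The projection from chains to chains modulo boundaries as a linear map. -/
abbrev pOp (p : ℤ) : K.X p →ₗ[R] K.opcycles p := (K.pOpcycles p).hom

/-- The inclusion of homology into chains modulo boundaries as a linear map. -/
abbrev ιHom (p : ℤ) : K.homology p →ₗ[R] K.opcycles p := (K.homologyι p).hom

/-- The differential with values in the cycles as a linear map. -/
abbrev toCyc (p q : ℤ) : K.X p →ₗ[R] K.cycles q := (K.toCycles p q).hom

/-- The differential on chains modulo boundaries as a linear map. -/
abbrev fromOp (p q : ℤ) : K.opcycles p →ₗ[R] K.X q := (K.fromOpcycles p q).hom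

/-- The boundaries, as a submodule of the cycles. -/
def bdry (q : ℤ) : Submodule R (K.cycles q) := LinearMap.range (toCyc K (q + 1) q)

/-- The differential with values in the boundaries. -/
def toBdry {p q : ℤ} (h : q + 1 = p) : K.X p →ₗ[R] bdry K q :=
  (toCyc K p q).codRestrict _ fun x => by
    subst h
    exact ⟨x, rfl⟩

variable {K}

theorem iCyc_injective (p : ℤ) : Function.Injective (iCyc K p) :=
  (ModuleCat.mono_iff_injective _).1 inferInstance

theorem πHom_surjective (p : ℤ) : Function.Surjective (πHom K p) :=
  (ModuleCat.epi_iff_surjective _).1 inferInstance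

theorem pOp_surjective (p : ℤ) : Function.Surjective (pOp K p) :=
  (ModuleCat.epi_iff_surjective _).1 inferInstance

theorem ιHom_injective (p : ℤ) : Function.Injective (ιHom K p) :=
  (ModuleCat.mono_iff_injective _).1 inferInstance

theorem exact_iCyc_dLin {p q : ℤ} (h : q + 1 = p) : Function.Exact (iCyc K p) (dLin K p q) :=
  (ShortComplex.ShortExact.moduleCat_exact_iff_function_exact _).1
    (ShortComplex.exact_of_f_is_kernel (ShortComplex.mk (K.iCycles p) (K.d p q) (by simp))
      (K.cyclesIsKernel p q (ComplexShape.next_eq' _ h)))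

theorem exact_toCyc_πHom {p q : ℤ} (h : q + 1 = p) : Function.Exact (toCyc K p q) (πHom K q) :=
  (ShortComplex.ShortExact.moduleCat_exact_iff_function_exact _).1
    (ShortComplex.exact_of_g_is_cokernel (ShortComplex.mk (K.toCycles p q) (K.homologyπ q) (by simp))
      (K.homologyIsCokernel p q (ComplexShape.prev_eq' _ h)))

theorem exact_dLin_pOp {p q : ℤ} (h : q + 1 = p) : Function.Exact (dLin K p q) (pOp K q) :=
  (ShortComplex.ShortExact.moduleCat_exact_iff_function_exact _).1
    (ShortComplex.exact_of_g_is_cokernel (ShortComplex.mk (K.d p q) (K.pOpcycles q) (by simp))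
      (K.opcyclesIsCokernel p q (ComplexShape.prev_eq' _ h)))

theorem exact_ιHom_fromOp {p q : ℤ} (h : q + 1 = p) : Function.Exact (ιHom K p) (fromOp K p q) :=
  (ShortComplex.ShortExact.moduleCat_exact_iff_function_exact _).1
    (ShortComplex.exact_of_f_is_kernel
      (ShortComplex.mk (K.homologyι p) (K.fromOpcycles p q) (by simp))
      (K.homologyIsKernel p q (ComplexShape.next_eq' _ h)))

theorem dLin_comp_iCyc (p q : ℤ) : dLin K p q ∘ₗ iCyc K p = 0 :=
  congrArg ModuleCat.Hom.hom (K.iCycles_d p q)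

theorem iCyc_comp_toCyc (p q : ℤ) : iCyc K q ∘ₗ toCyc K p q = dLin K p q :=
  congrArg ModuleCat.Hom.hom (K.toCycles_i p q)

theorem fromOp_comp_pOp (p q : ℤ) : fromOp K p q ∘ₗ pOp K p = dLin K p q :=
  congrArg ModuleCat.Hom.hom (K.p_fromOpcycles p q)

theorem pOp_comp_dLin (p q : ℤ) : pOp K q ∘ₗ dLin K p q = 0 :=
  congrArg ModuleCat.Hom.hom (K.d_pOpcycles p q)

theorem pOp_comp_iCyc (p : ℤ) : pOp K p ∘ₗ iCyc K p = ιHom K p ∘ₗ πHom K p :=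
  (congrArg ModuleCat.Hom.hom (K.homology_π_ι p)).symm

theorem πHom_comp_toCyc (p q : ℤ) : πHom K q ∘ₗ toCyc K p q = 0 :=
  congrArg ModuleCat.Hom.hom (K.toCycles_comp_homologyπ p q)

theorem iCyc_comp_subtype_comp_toBdry {p q : ℤ} (h : q + 1 = p) :
    iCyc K q ∘ₗ (bdry K q).subtype ∘ₗ toBdry K h = dLin K p q :=
  iCyc_comp_toCyc p q

theorem toBdry_surjective {p q : ℤ} (h : q + 1 = p) : Function.Surjective (toBdry K h) := by
  subst h
  rintro ⟨_, x, rfl⟩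
  exact ⟨x, rfl⟩

theorem exact_iCyc_toBdry {p q : ℤ} (h : q + 1 = p) : Function.Exact (iCyc K p) (toBdry K h) := by
  intro x
  rw [← exact_iCyc_dLin h x, ← iCyc_comp_subtype_comp_toBdry h]
  simp [(injective_iff_map_eq_zero' _).1 (iCyc_injective (K := K) q)]

theorem toBdry_comp_iCyc {p q : ℤ} (h : q + 1 = p) : toBdry K h ∘ₗ iCyc K p = 0 :=
  LinearMap.ext (exact_iCyc_toBdry h).apply_apply_eq_zero

theorem toBdry_comp_dLin {p q r : ℤ} (h : q + 1 = p) : toBdry K h ∘ₗ dLin K r p = 0 := by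
  rw [← iCyc_comp_toCyc, ← LinearMap.comp_assoc, toBdry_comp_iCyc, LinearMap.zero_comp]

theorem exact_subtype_πHom (q : ℤ) : Function.Exact (bdry K q).subtype (πHom K q) := by
  intro x
  rw [exact_toCyc_πHom (p := q + 1) rfl x]
  constructor
  · rintro ⟨y, rfl⟩
    exact ⟨⟨_, y, rfl⟩, rfl⟩
  · rintro ⟨⟨_, y, rfl⟩, rfl⟩
    exact ⟨y, rfl⟩

variable {L}

theorem cyclesMap_mem_bdry (φ : K ⟶ L) (q : ℤ) (x : K.cycles q) (hx : x ∈ bdry K q) :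
    (cyclesMap φ q).hom x ∈ bdry L q := by
  obtain ⟨y, rfl⟩ := hx
  refine ⟨(φ.f (q + 1)).hom y, iCyc_injective q ?_⟩
  have h : φ.f (q + 1) ≫ L.toCycles (q + 1) q ≫ L.iCycles q =
      K.toCycles (q + 1) q ≫ cyclesMap φ q ≫ L.iCycles q := by simp
  exact congrArg (fun f => f.hom y) h

/-- The map induced on boundaries. -/
def bdryMap (φ : K ⟶ L) (q : ℤ) : bdry K q →ₗ[R] bdry L q :=
  (cyclesMap φ q).hom.restrict (cyclesMap_mem_bdry φ q)

theorem bdryMap_comp_toBdry (φ : K ⟶ L) {p q : ℤ} (h : q + 1 = p) :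
    bdryMap φ q ∘ₗ toBdry K h = toBdry L h ∘ₗ (φ.f p).hom := by
  refine LinearMap.ext fun x => Subtype.ext (iCyc_injective q ?_)
  have h : φ.f p ≫ L.toCycles p q ≫ L.iCycles q =
      K.toCycles p q ≫ cyclesMap φ q ≫ L.iCycles q := by simp
  exact congrArg (fun f => f.hom x) h.symm

/-- A complex of finitely generated torsion-free modules. -/
class FiniteTorsionFree (K : Cx R) : Prop where
  finite : ∀ p, Module.Finite R (K.X p)
  torsionFree : ∀ p, Module.IsTorsionFree R (K.X p)

attribute [instance] FiniteTorsionFree.finite FiniteTorsionFree.torsionFree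

variable [IsDomain R] [IsPrincipalIdealRing R] [FiniteTorsionFree K]

instance (p : ℤ) : Module.Finite R (K.cycles p) :=
  Module.Finite.of_injective (iCyc K p) (iCyc_injective p)

instance (p : ℤ) : Module.IsTorsionFree R (K.cycles p) :=
  (iCyc_injective (K := K) p).moduleIsTorsionFree _ (map_smul _)

instance (p : ℤ) : Module.Free R (K.cycles p) :=
  Module.free_of_finite_type_torsion_free'

instance (p : ℤ) : Module.Projective R (K.cycles p) :=
  Module.Projective.of_free

/-- The boundaries form a submodule of a finite free module over a principal ideal domain, hence are
projective, and the surjection from chains to boundaries splits. -/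
theorem exists_retraction (p : ℤ) : ∃ s : K.X p →ₗ[R] K.cycles p, s ∘ₗ iCyc K p = LinearMap.id := by
  have h : p - 1 + 1 = p := by omega
  refine (((exact_iCyc_toBdry h).split_tfae (iCyc_injective p) (toBdry_surjective h)).out 0 1).1 ?_
  exact Module.projective_lifting_property _ _ (toBdry_surjective h)

variable (K)

/-- The presentation of homology by cycles and boundaries. -/
def homologyPresentation (q : ℤ) :
    Presentation (ModuleCat.of R (bdry K q)) (K.cycles q) (K.homology q) where
  f := ModuleCat.ofHom (bdry K q).subtype
  g := K.homologyπ q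
  projective_left := (IsProjective.iff_projective _).1 inferInstance
  projective_right := (K.cycles q).projective_of_categoryTheory_projective
  injective := (bdry K q).injective_subtype
  surjective := πHom_surjective q
  exact := exact_subtype_πHom q

end Complexes

/-! ### `Tor₁` of homology inside (chains modulo boundaries) ⊗ boundaries. -/

section TorComparison

open HomologicalComplex TensorProduct

variable {R : Type u} [CommRing R] [IsDomain R] [IsPrincipalIdealRing R]
variable (C D : Cx R) [FiniteTorsionFree D]

/-- The module `Tor₁(H_p(C), H_q(D))`. -/
abbrev TorH (p q : ℤ) : ModuleCat.{u} R :=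
  ((Tor (ModuleCat.{u} R) 1).obj (C.homology p)).obj (D.homology q)

/-- The inclusion of `Tor₁(H_p(C), H_q(D))` into the tensor product of the chains of `C` modulo
boundaries and the boundaries of `D`. -/
def torEmb (p q : ℤ) : TorH C D p q →ₗ[R] C.opcycles p ⊗[R] bdry D q :=
  TensorProduct.map (ιHom C p) LinearMap.id ∘ₗ
    ((homologyPresentation D q).torIncl (C.homology p)).hom

theorem torEmb_injective (p q : ℤ) : Function.Injective (torEmb C D p q) :=
  (map_id_injective (ιHom_injective p)).comp ((homologyPresentation D q).torIncl_injective _)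

variable {C D}

/-- As the boundaries of `D` are flat, `h` says that `y` comes from `H_p(C) ⊗ B_q`. It then remains
to see that this element dies in `H_p(C) ⊗ Z_q`, which follows from `h'` because `H_p(C) ⊗ Z_q`
embeds in (chains of `C` modulo boundaries) `⊗ D_q`. -/
theorem mem_range_torEmb {p p' q : ℤ} (hp : p' + 1 = p) (y : C.opcycles p ⊗[R] bdry D q)
    (h : TensorProduct.map (fromOp C p p') LinearMap.id y = 0)
    (h' : TensorProduct.map LinearMap.id (iCyc D q ∘ₗ (bdry D q).subtype) y = 0) :
    y ∈ LinearMap.range (torEmb C D p q) := by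
  obtain ⟨k, rfl⟩ := (map_id_exact_of_flat (M := bdry D q) (exact_ιHom_fromOp (K := C) hp) y).1 h
  -- Chains of `C` modulo boundaries need not be flat, so `Z_q → D_q` has to be split for the
  -- tensored map to stay injective.
  obtain ⟨s, hs⟩ := exists_retraction (K := D) q
  have hk : TensorProduct.map (LinearMap.id : C.homology p →ₗ[R] _) (bdry D q).subtype k = 0 := by
    apply map_id_injective (M := D.cycles q) (ιHom_injective (K := C) p)
    apply id_map_injective_of_retraction (M := C.opcycles p) hs
    rw [map_zero, map_zero, ← h', TensorProduct.map_map, TensorProduct.map_map,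
      TensorProduct.map_map]
    rfl
  obtain ⟨t, rfl⟩ := (homologyPresentation D q).exists_torIncl_eq (C.homology p) k hk
  exact ⟨t, rfl⟩

/-- Lift `t ∈ H_p(C) ⊗ B_q` to `a ∈ Z_p ⊗ D_{q+1}`. That `t` vanishes in `H_p(C) ⊗ Z_q` means that
differentiating the right factor of `a` gives something bounded on the left by some `b`. The pair
`(a, b)` is what is needed to assemble a cycle of the total complex. -/
theorem exists_lift_torEmb {p p₁ q q₁ : ℤ} (hp : p + 1 = p₁) (hq : q + 1 = q₁) (t : TorH C D p q) :
    ∃ (a : C.cycles p ⊗[R] D.X q₁) (b : C.X p₁ ⊗[R] D.cycles q),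
      TensorProduct.map (ιHom C p ∘ₗ πHom C p) (toBdry D hq) a = torEmb C D p q t ∧
      TensorProduct.map (iCyc C p) (dLin D q₁ q) a =
        TensorProduct.map (dLin C p₁ p) (iCyc D q) b := by
  obtain ⟨a, ha⟩ := TensorProduct.map_surjective (πHom_surjective (K := C) p)
    (toBdry_surjective (K := D) hq) ((homologyPresentation D q).torIncl (C.homology p) t)
  have h0 := congrArg (fun f => f.hom t) ((homologyPresentation D q).torIncl_comp (C.homology p))
  have h1 : TensorProduct.map (πHom C p) LinearMap.id
      (TensorProduct.map LinearMap.id ((bdry D q).subtype ∘ₗ toBdry D hq) a) = 0 := by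
    refine Eq.trans ?_ h0
    rw [TensorProduct.map_map]
    refine Eq.trans ?_ (congrArg (TensorProduct.map LinearMap.id (bdry D q).subtype) ha)
    rw [TensorProduct.map_map]
    rfl
  obtain ⟨b, hb⟩ := (map_id_exact (M := D.cycles q) (exact_toCyc_πHom (K := C) hp)
    (πHom_surjective p) _).1 h1
  refine ⟨a, b, ?_, ?_⟩
  · rw [torEmb, LinearMap.comp_apply]
    refine Eq.trans ?_ (congrArg (TensorProduct.map (ιHom C p) LinearMap.id) ha)
    rw [TensorProduct.map_map]
    rfl
  · have := congrArg (TensorProduct.map (iCyc C p) (iCyc D q)) hb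
    rw [TensorProduct.map_map, TensorProduct.map_map, iCyc_comp_toCyc,
      iCyc_comp_subtype_comp_toBdry] at this
    exact this.symm

theorem torEmb_naturality {C' D' : Cx R} [FiniteTorsionFree D'] (φ : C ⟶ C') (ψ : D ⟶ D') (p q : ℤ)
    (t : TorH C D p q) :
    torEmb C' D' p q
        (((Tor (ModuleCat.{u} R) 1).obj (C'.homology p)).map (homologyMap ψ q)
          (((Tor (ModuleCat.{u} R) 1).map (homologyMap φ p)).app (D.homology q) t)) =
      TensorProduct.map (opcyclesMap φ p).hom (bdryMap ψ q) (torEmb C D p q t) := by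
  have h₁ := (homologyPresentation D q).torIncl_naturality_left (homologyMap φ p)
  have h₂ := (homologyPresentation D q).torIncl_naturality_right (homologyPresentation D' q)
    (C'.homology p) (ModuleCat.ofHom (bdryMap ψ q)) (cyclesMap ψ q) (homologyMap ψ q) rfl
    (homologyπ_naturality ψ q).symm
  have h₁' := congrArg (fun f => f.hom t) h₁
  have h₂' := congrArg (fun f => f.hom
    (((Tor (ModuleCat.{u} R) 1).map (homologyMap φ p)).app (D.homology q) t)) h₂
  have h₃ : ιHom C' p ∘ₗ (homologyMap φ p).hom = (opcyclesMap φ p).hom ∘ₗ ιHom C p :=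
    congrArg ModuleCat.Hom.hom (homologyι_naturality φ p)
  refine (congrArg (TensorProduct.map (ιHom C' p) LinearMap.id) (h₂'.trans
    (congrArg (TensorProduct.map LinearMap.id (bdryMap ψ q)) h₁'))).trans ?_
  refine ((congrArg (TensorProduct.map (ιHom C' p) LinearMap.id)
    (TensorProduct.map_map _ _ _ _ _)).trans (TensorProduct.map_map _ _ _ _ _)).trans ?_
  refine Eq.trans ?_ (TensorProduct.map_map _ _ _ _ _).symm
  rw [LinearMap.id_comp, h₃]
  rfl

end TorComparison

/-! ### The Künneth sequence -/

section Kunneth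

open HomologicalComplex TensorProduct

variable {R : Type u} [CommRing R]

/-- The sign `(-1)^(p+1)`. -/
def sgn (R : Type u) [CommRing R] (p : ℤ) : R := (((p + 1).negOnePow : ℤ) : R)

theorem sgn_mul_self (p : ℤ) : sgn R p * sgn R p = 1 := by
  rw [sgn, ← Int.cast_mul, ← Units.val_mul, Int.units_mul_self]
  simp

theorem sgn_smul_smul {M : Type*} [AddCommGroup M] [Module R M] (p : ℤ) (x : M) :
    sgn R p • sgn R p • x = x := by
  rw [smul_smul, sgn_mul_self, one_smul]

theorem sgn_smul_eq_zero {M : Type*} [AddCommGroup M] [Module R M] {p : ℤ} {x : M}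
    (h : sgn R p • x = 0) : x = 0 := by
  rw [← sgn_smul_smul (R := R) p x, h, smul_zero]

/-- An identification of the complex `T` with the tensor product of `C` and `D`, where the total
degree of `C_p ⊗ D_q` is `p + q + 1`. -/
structure ShiftedTensor (C D T : Cx R) where
  /-- The inclusion of a summand. -/
  cat : ∀ p q r : ℤ, p + q + 1 = r → C.X p ⊗[R] D.X q →ₗ[R] T.X r
  /-- The projection to a summand. -/
  comp : ∀ p q r : ℤ, p + q + 1 = r → T.X r →ₗ[R] C.X p ⊗[R] D.X q
  comp_cat : ∀ {p q r : ℤ} (h : p + q + 1 = r) (t : C.X p ⊗[R] D.X q),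
    comp p q r h (cat p q r h t) = t
  comp_cat_of_ne : ∀ {p q p' q' r : ℤ} (h : p + q + 1 = r) (h' : p' + q' + 1 = r), p ≠ p' →
    ∀ t : C.X p ⊗[R] D.X q, comp p' q' r h' (cat p q r h t) = 0
  ext_zero : ∀ {r : ℤ} (v : T.X r), (∀ p q h, comp p q r h v = 0) → v = 0
  d_cat : ∀ {p p' q q' r r' : ℤ} (hp : p' + 1 = p) (hq : q' + 1 = q) (_ : r' + 1 = r)
    (h : p + q + 1 = r) (t : C.X p ⊗[R] D.X q),
    dLin T r r' (cat p q r h t) =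
      cat p' q r' (by omega) (TensorProduct.map (dLin C p p') LinearMap.id t) +
        sgn R p • cat p q' r' (by omega) (TensorProduct.map LinearMap.id (dLin D q q') t)
  comp_d : ∀ {p p' q q' r r' : ℤ} (hp : p' + 1 = p) (hq : q' + 1 = q) (_ : r' + 1 = r)
    (h : p' + q' + 1 = r') (v : T.X r),
    comp p' q' r' h (dLin T r r' v) =
      TensorProduct.map (dLin C p p') LinearMap.id (comp p q' r (by omega) v) +
        sgn R p' • TensorProduct.map LinearMap.id (dLin D q q') (comp p' q r (by omega) v)
  left_subsingleton : ∀ p, p < -1 → Subsingleton (C.X p)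
  right_subsingleton : ∀ q, q < -1 → Subsingleton (D.X q)

instance (r : ℤ) : Finite (Idx r) := by
  refine Finite.of_injective (β := Finset.Icc (-1) r)
    (fun x => ⟨x.1.1, Finset.mem_Icc.2 ⟨x.2.1, by have := x.2.2; omega⟩⟩) ?_
  rintro ⟨⟨p, q⟩, h⟩ ⟨⟨p', q'⟩, h'⟩ e
  have e : p = p' := congrArg Subtype.val e
  simp only at h h'
  refine Subtype.ext (Prod.ext e ?_)
  simp only
  omega

instance (r : ℤ) : Fintype (Idx r) := Fintype.ofFinite _

theorem Idx.add_one {r : ℤ} (x : Idx r) : x.1.1 + x.1.2 + 1 = r := by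
  have := x.2.2
  omega

theorem Idx.fst_ne {r : ℤ} {x y : Idx r} (h : x ≠ y) : x.1.1 ≠ y.1.1 := fun e =>
  h (Subtype.ext (Prod.ext e (by have := x.add_one; have := y.add_one; omega)))

namespace ShiftedTensor

variable {C D T : Cx R} (S : ShiftedTensor C D T)

theorem comp_eq_zero {p q r : ℤ} (h : p + q + 1 = r) (hpq : p < -1 ∨ q < -1) (v : T.X r) :
    S.comp p q r h v = 0 := by
  have : Subsingleton (C.X p ⊗[R] D.X q) := by
    rcases hpq with hpq | hpq
    · have := S.left_subsingleton p hpq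
      infer_instance
    · have := S.right_subsingleton q hpq
      infer_instance
  exact Subsingleton.elim _ _

/-- Bidegrees outside `Idx r` have `p < -1` or `q < -1`, where the chains vanish; finitely many
components therefore determine an element. -/
theorem ext_idx {r : ℤ} {v w : T.X r}
    (h : ∀ x : Idx r, S.comp x.1.1 x.1.2 r x.add_one v = S.comp x.1.1 x.1.2 r x.add_one w) :
    v = w := by
  rw [← sub_eq_zero]
  refine S.ext_zero _ fun p q hpq => ?_
  by_cases hpq' : p < -1 ∨ q < -1
  · exact S.comp_eq_zero hpq hpq' _
  · rw [map_sub, sub_eq_zero]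
    exact h ⟨(p, q), by omega, by omega, by omega⟩

theorem comp_sum {r : ℤ} (t : ∀ x : Idx r, C.X x.1.1 ⊗[R] D.X x.1.2) (y : Idx r) :
    S.comp y.1.1 y.1.2 r y.add_one (∑ x, S.cat x.1.1 x.1.2 r x.add_one (t x)) = t y := by
  rw [map_sum, Finset.sum_eq_single y]
  · exact S.comp_cat _ _
  · exact fun x _ hx => S.comp_cat_of_ne _ _ (Idx.fst_ne hx) _
  · exact fun hy => (hy (Finset.mem_univ y)).elim

theorem sum_cat_comp {r : ℤ} (v : T.X r) :
    ∑ x : Idx r, S.cat x.1.1 x.1.2 r x.add_one (S.comp x.1.1 x.1.2 r x.add_one v) = v :=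
  S.ext_idx fun y => S.comp_sum _ y

/-! #### The cross product -/

/-- The cross product of cycles. -/
def crossCycles (p q r : ℤ) (h : p + q + 1 = r) :
    C.cycles p ⊗[R] D.cycles q →ₗ[R] T.cycles r :=
  (T.liftCycles (A := ModuleCat.of R (C.cycles p ⊗[R] D.cycles q))
    (ModuleCat.ofHom (S.cat p q r h ∘ₗ TensorProduct.map (iCyc C p) (iCyc D q))) (r - 1)
    (ComplexShape.next_eq' _ (sub_add_cancel r 1))
    (ModuleCat.hom_ext (LinearMap.ext fun t => by
      change dLin T r (r - 1) (S.cat p q r h (TensorProduct.map (iCyc C p) (iCyc D q) t)) = 0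
      rw [S.d_cat (sub_add_cancel p 1) (sub_add_cancel q 1) (sub_add_cancel r 1),
        TensorProduct.map_map, TensorProduct.map_map, dLin_comp_iCyc, dLin_comp_iCyc]
      simp))).hom

theorem iCyc_crossCycles (p q r : ℤ) (h : p + q + 1 = r) (t : C.cycles p ⊗[R] D.cycles q) :
    iCyc T r (S.crossCycles p q r h t) = S.cat p q r h (TensorProduct.map (iCyc C p) (iCyc D q) t) :=
  congrArg (fun f : ModuleCat.of R (C.cycles p ⊗[R] D.cycles q) ⟶ T.X r => f.hom t)
    (T.liftCycles_i _ _ _ _)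

theorem πHom_eq_of_iCyc_eq {K : Cx R} {r₁ r : ℤ} (z : K.cycles r) (v : K.X r₁)
    (h : iCyc K r z = dLin K r₁ r v) : πHom K r z = 0 := by
  have hz : z = toCyc K r₁ r v := iCyc_injective r (h.trans
    (LinearMap.congr_fun (iCyc_comp_toCyc r₁ r) v).symm)
  rw [hz]
  exact LinearMap.congr_fun (πHom_comp_toCyc r₁ r) v

/-- The kernel of `Z ⊗ Z → H ⊗ H` is generated by `Z ⊗ B` and `B ⊗ Z`, and the product of a cycle
with a boundary is a boundary by the Leibniz rule. -/
theorem πHom_crossCycles_eq_zero (p q r : ℤ) (h : p + q + 1 = r) (t : C.cycles p ⊗[R] D.cycles q)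
    (ht : TensorProduct.map (πHom C p) (πHom D q) t = 0) :
    πHom T r (S.crossCycles p q r h t) = 0 := by
  have ht' : t ∈ LinearMap.ker (TensorProduct.map (πHom C p) (πHom D q)) := ht
  rw [TensorProduct.map_ker (exact_toCyc_πHom (K := C) (p := p + 1) rfl) (πHom_surjective p)
    (exact_toCyc_πHom (K := D) (p := q + 1) rfl) (πHom_surjective q)] at ht'
  obtain ⟨_, ⟨x, rfl⟩, _, ⟨y, rfl⟩, rfl⟩ := Submodule.mem_sup.1 ht'
  rw [map_add, map_add]
  have hx : πHom T r (S.crossCycles p q r h (LinearMap.lTensor _ (toCyc D (q + 1) q) x)) = 0 := by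
    -- The factor `sgn R p` cancels the sign that the Leibniz rule puts on the right differential.
    refine πHom_eq_of_iCyc_eq (r₁ := r + 1) _ (sgn R p • S.cat p (q + 1) (r + 1) (by omega)
      (TensorProduct.map (iCyc C p) LinearMap.id x)) ?_
    rw [map_smul, S.d_cat (p' := p - 1) (q' := q) (by omega) (by omega) (by omega),
      iCyc_crossCycles, LinearMap.lTensor, TensorProduct.map_map, TensorProduct.map_map,
      TensorProduct.map_map, dLin_comp_iCyc, iCyc_comp_toCyc, TensorProduct.map_zero_left,
      LinearMap.zero_apply, map_zero, zero_add, sgn_smul_smul]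
    rfl
  have hy : πHom T r (S.crossCycles p q r h (LinearMap.rTensor _ (toCyc C (p + 1) p) y)) = 0 := by
    refine πHom_eq_of_iCyc_eq (r₁ := r + 1) _ (S.cat (p + 1) q (r + 1) (by omega)
      (TensorProduct.map LinearMap.id (iCyc D q) y)) ?_
    rw [S.d_cat (p' := p) (q' := q - 1) (by omega) (by omega) (by omega),
      iCyc_crossCycles, LinearMap.rTensor, TensorProduct.map_map, TensorProduct.map_map,
      TensorProduct.map_map, dLin_comp_iCyc, iCyc_comp_toCyc, TensorProduct.map_zero_right,
      LinearMap.zero_apply, map_zero, smul_zero, add_zero]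
    rfl
  rw [hx, hy, add_zero]

/-- The homology cross product. -/
def cross (p q r : ℤ) (h : p + q + 1 = r) :
    C.homology p ⊗[R] D.homology q →ₗ[R] T.homology r :=
  descend (TensorProduct.map (πHom C p) (πHom D q))
    (TensorProduct.map_surjective (πHom_surjective p) (πHom_surjective q))
    (πHom T r ∘ₗ S.crossCycles p q r h) (S.πHom_crossCycles_eq_zero p q r h)

theorem cross_map_πHom (p q r : ℤ) (h : p + q + 1 = r) (t : C.cycles p ⊗[R] D.cycles q) :
    S.cross p q r h (TensorProduct.map (πHom C p) (πHom D q) t) =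
      πHom T r (S.crossCycles p q r h t) :=
  descend_apply _ _ _ _ t

/-! #### The projection to the torsion part -/

/-- The chain level description of the projection to the torsion part. -/
def torChain (p q q' r : ℤ) (hq : q' + 1 = q) (h : p + q + 1 = r) :
    T.cycles r →ₗ[R] C.opcycles p ⊗[R] bdry D q' :=
  TensorProduct.map (pOp C p) (toBdry D hq) ∘ₗ S.comp p q r h ∘ₗ iCyc T r

theorem torChain_apply (p q q' r : ℤ) (hq : q' + 1 = q) (h : p + q + 1 = r) (z : T.cycles r) :
    S.torChain p q q' r hq h z =
      TensorProduct.map (pOp C p) (toBdry D hq) (S.comp p q r h (iCyc T r z)) :=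
  rfl

/-- The component of `∂z = 0` in bidegree `(p', q')` receives contributions only from the neighbours
`(p, q')` and `(p', q)`; they cancel. -/
theorem map_comp_d {p p' q q' r r' : ℤ} (hp : p' + 1 = p) (hq : q' + 1 = q) (hr : r' + 1 = r)
    (h : p' + q' + 1 = r') {z : T.X r} (hz : dLin T r r' z = 0) :
    TensorProduct.map (dLin C p p') LinearMap.id (S.comp p q' r (by omega) z) =
      -(sgn R p' • TensorProduct.map LinearMap.id (dLin D q q') (S.comp p' q r (by omega) z)) := by
  rw [eq_neg_iff_add_eq_zero, ← S.comp_d hp hq hr h, hz, map_zero]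

theorem dLin_iCyc (K : Cx R) (r r' : ℤ) (z : K.cycles r) : dLin K r r' (iCyc K r z) = 0 :=
  LinearMap.congr_fun (dLin_comp_iCyc r r') z

/-- A component of a boundary has a part differentiated on the left, killed modulo boundaries of
`C`, and a part differentiated on the right, killed by a second differential of `D`. -/
theorem torChain_eq_zero (p q q' r : ℤ) (hq : q' + 1 = q) (h : p + q + 1 = r)
    (z : T.cycles r) (hz : πHom T r z = 0) : S.torChain p q q' r hq h z = 0 := by
  obtain ⟨v, rfl⟩ := (exact_toCyc_πHom (K := T) (p := r + 1) rfl z).1 hz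
  have : iCyc T r (toCyc T (r + 1) r v) = dLin T (r + 1) r v :=
    LinearMap.congr_fun (iCyc_comp_toCyc _ _) v
  rw [torChain_apply, this, S.comp_d (p := p + 1) (q := q + 1) rfl rfl rfl h, map_add, map_smul,
    TensorProduct.map_map, TensorProduct.map_map, pOp_comp_dLin, toBdry_comp_dLin,
    TensorProduct.map_zero_left, TensorProduct.map_zero_right]
  simp

variable [IsDomain R] [IsPrincipalIdealRing R] [FiniteTorsionFree D]

/-- Both conditions of `mem_range_torEmb` come from the cycle relation `map_comp_d`. Differentiating
the component on the left equals, up to sign, differentiating its neighbour at `(p - 1, q + 1)` on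
the right, which `toBdry` kills. Differentiating it on the right equals, up to sign, differentiating
the neighbour at `(p + 1, q')` on the left, which `pOp` kills. -/
theorem torChain_mem_range (p q q' r : ℤ) (hq : q' + 1 = q) (h : p + q + 1 = r)
    (z : T.cycles r) : S.torChain p q q' r hq h z ∈ LinearMap.range (torEmb C D p q') := by
  have hz := dLin_iCyc T r (r - 1) z
  refine mem_range_torEmb (sub_add_cancel p 1) _ ?_ ?_
  · rw [torChain_apply, TensorProduct.map_map, fromOp_comp_pOp]
    have h1 := congrArg (TensorProduct.map LinearMap.id (toBdry D hq))
      (S.map_comp_d (sub_add_cancel p 1) (q' := q) rfl (sub_add_cancel r 1) (by omega) hz)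
    rw [map_neg, map_smul, TensorProduct.map_map, TensorProduct.map_map, toBdry_comp_dLin,
      TensorProduct.map_zero_right, LinearMap.zero_apply, smul_zero, neg_zero] at h1
    exact h1
  · rw [torChain_apply, TensorProduct.map_map, LinearMap.comp_assoc, iCyc_comp_subtype_comp_toBdry]
    have h1 := congrArg (TensorProduct.map (pOp C p) LinearMap.id)
      (S.map_comp_d (p := p + 1) (p' := p) rfl hq (sub_add_cancel r 1) (by omega) hz)
    rw [map_neg, map_smul, TensorProduct.map_map, TensorProduct.map_map, pOp_comp_dLin,
      TensorProduct.map_zero_left, LinearMap.zero_apply, zero_eq_neg] at h1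
    exact sgn_smul_eq_zero h1

/-- The projection from the homology of `T` to `Tor₁(H_p(C), H_{q-1}(D))`. -/
def torPart (p q q' r : ℤ) (hq : q' + 1 = q) (h : p + q + 1 = r) :
    T.homology r →ₗ[R] TorH C D p q' :=
  descend (πHom T r) (πHom_surjective r)
    (liftRange (torEmb C D p q') (torEmb_injective C D p q') (S.torChain p q q' r hq h)
      (S.torChain_mem_range p q q' r hq h))
    fun z hz => torEmb_injective C D p q' (by
      rw [liftRange_apply, S.torChain_eq_zero _ _ _ _ _ _ _ hz, map_zero])

theorem torEmb_torPart (p q q' r : ℤ) (hq : q' + 1 = q) (h : p + q + 1 = r) (z : T.cycles r) :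
    torEmb C D p q' (S.torPart p q q' r hq h (πHom T r z)) = S.torChain p q q' r hq h z := by
  rw [torPart, descend_apply, liftRange_apply]

theorem torPart_cross (p₀ q₀ p q q' r : ℤ) (h₀ : p₀ + q₀ + 1 = r) (hq : q' + 1 = q)
    (h : p + q + 1 = r) (t : C.homology p₀ ⊗[R] D.homology q₀) :
    S.torPart p q q' r hq h (S.cross p₀ q₀ r h₀ t) = 0 := by
  obtain ⟨z, rfl⟩ := TensorProduct.map_surjective (πHom_surjective (K := C) p₀)
    (πHom_surjective (K := D) q₀) t
  apply torEmb_injective C D p q'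
  rw [cross_map_πHom, torEmb_torPart, torChain_apply, iCyc_crossCycles, map_zero]
  by_cases hp : p₀ = p
  · subst hp
    obtain rfl : q₀ = q := by omega
    rw [S.comp_cat, TensorProduct.map_map, toBdry_comp_iCyc, TensorProduct.map_zero_right,
      LinearMap.zero_apply]
  · rw [S.comp_cat_of_ne _ _ hp, map_zero]

end ShiftedTensor

end Kunneth

/-! ### Exactness, splitting and naturality of the Künneth sequence. -/

section KunnethExact

open HomologicalComplex TensorProduct

variable {R : Type u} [CommRing R]

namespace ShiftedTensor

variable {C D T : Cx R} (S : ShiftedTensor C D T)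

variable [IsDomain R] [IsPrincipalIdealRing R]

/-- Retracting chains onto cycles in both factors and passing to homology gives a map on the `(p,
q)` component that kills boundaries, so it descends to the homology of `T`. It depends on the
retractions `s`, `s'`. -/
theorem exists_retraction_cross [FiniteTorsionFree C] [FiniteTorsionFree D] (p q r : ℤ)
    (h : p + q + 1 = r) :
    ∃ ρ : T.homology r →ₗ[R] C.homology p ⊗[R] D.homology q,
      (∀ t, ρ (S.cross p q r h t) = t) ∧
      ∀ p' q' (h' : p' + q' + 1 = r) t, p' ≠ p → ρ (S.cross p' q' r h' t) = 0 := by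
  obtain ⟨s, hs⟩ := exists_retraction (K := C) p
  obtain ⟨s', hs'⟩ := exists_retraction (K := D) q
  have hd : (πHom C p ∘ₗ s) ∘ₗ dLin C (p + 1) p = 0 := by
    rw [← iCyc_comp_toCyc, LinearMap.comp_assoc, ← LinearMap.comp_assoc _ _ s, hs, LinearMap.id_comp,
      πHom_comp_toCyc]
  have hd' : (πHom D q ∘ₗ s') ∘ₗ dLin D (q + 1) q = 0 := by
    rw [← iCyc_comp_toCyc, LinearMap.comp_assoc, ← LinearMap.comp_assoc _ _ s', hs', LinearMap.id_comp,
      πHom_comp_toCyc]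
  have hk : ∀ z, πHom T r z = 0 → (TensorProduct.map (πHom C p ∘ₗ s) (πHom D q ∘ₗ s') ∘ₗ
      S.comp p q r h ∘ₗ iCyc T r) z = 0 := by
    intro z hz
    obtain ⟨v, rfl⟩ := (exact_toCyc_πHom (K := T) (p := r + 1) rfl z).1 hz
    have : iCyc T r (toCyc T (r + 1) r v) = dLin T (r + 1) r v :=
      LinearMap.congr_fun (iCyc_comp_toCyc _ _) v
    rw [LinearMap.comp_apply, LinearMap.comp_apply, this,
      S.comp_d (p := p + 1) (q := q + 1) rfl rfl rfl h, map_add, map_smul,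
      TensorProduct.map_map, TensorProduct.map_map, hd, hd',
      TensorProduct.map_zero_left, TensorProduct.map_zero_right]
    simp
  refine ⟨descend (πHom T r) (πHom_surjective r) _ hk, fun t => ?_, fun p' q' h' t hp => ?_⟩
  · obtain ⟨z, rfl⟩ := TensorProduct.map_surjective (πHom_surjective (K := C) p)
      (πHom_surjective (K := D) q) t
    rw [cross_map_πHom, descend_apply, LinearMap.comp_apply, LinearMap.comp_apply,
      iCyc_crossCycles, S.comp_cat, TensorProduct.map_map, LinearMap.comp_assoc,
      LinearMap.comp_assoc, hs, hs', LinearMap.comp_id, LinearMap.comp_id]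
  · obtain ⟨z, rfl⟩ := TensorProduct.map_surjective (πHom_surjective (K := C) p')
      (πHom_surjective (K := D) q') t
    rw [cross_map_πHom, descend_apply, LinearMap.comp_apply, LinearMap.comp_apply,
      iCyc_crossCycles, S.comp_cat_of_ne _ _ hp, map_zero]

theorem exists_torPart_eq [FiniteTorsionFree D] (p q q' r : ℤ) (hq : q' + 1 = q)
    (h : p + q + 1 = r) (t : TorH C D p q') :
    ∃ z, S.torPart p q q' r hq h z = t ∧
      ∀ p₁ q₁ q₁' (hq₁ : q₁' + 1 = q₁) (h₁ : p₁ + q₁ + 1 = r), p₁ ≠ p →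
        S.torPart p₁ q₁ q₁' r hq₁ h₁ z = 0 := by
  obtain ⟨a, b, ha, hab⟩ := exists_lift_torEmb (p := p) (p₁ := p + 1) rfl hq t
  -- The left factor of `a` and the right factor of `b` are cycles, so each summand has a single
  -- boundary term, in bidegree `(p, q')`. The coefficient `sgn R p` makes the two terms cancel by
  -- `hab`.
  let v : T.X r := S.cat p q r h (TensorProduct.map (iCyc C p) LinearMap.id a) -
    sgn R p • S.cat (p + 1) q' r (by omega) (TensorProduct.map LinearMap.id (iCyc D q') b)
  have hv : dLin T r (r - 1) v = 0 := by
    rw [map_sub, map_smul, S.d_cat (sub_add_cancel p 1) hq (sub_add_cancel r 1),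
      S.d_cat (p' := p) rfl (sub_add_cancel q' 1) (sub_add_cancel r 1),
      TensorProduct.map_map, TensorProduct.map_map, TensorProduct.map_map, TensorProduct.map_map,
      dLin_comp_iCyc, dLin_comp_iCyc]
    simp only [TensorProduct.map_zero_left, TensorProduct.map_zero_right, LinearMap.zero_apply,
      map_zero, smul_zero, zero_add, add_zero, LinearMap.id_comp, LinearMap.comp_id]
    rw [hab, sub_self]
  obtain ⟨z, hz⟩ := (exact_iCyc_dLin (K := T) (sub_add_cancel r 1) v).1 hv
  refine ⟨πHom T r z, torEmb_injective C D p q' ?_, fun p₁ q₁ q₁' hq₁ h₁ hp₁ =>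
    torEmb_injective C D p₁ q₁' ?_⟩
  · rw [torEmb_torPart, torChain_apply, hz, map_sub, map_smul, S.comp_cat,
      S.comp_cat_of_ne _ _ (by omega), smul_zero, sub_zero, TensorProduct.map_map, ← ha,
      pOp_comp_iCyc]
    rfl
  · rw [torEmb_torPart, torChain_apply, hz, map_sub, map_smul, S.comp_cat_of_ne _ _ hp₁.symm,
      zero_sub, map_zero]
    -- The only other nonzero component of `v` is the one of `b`; its right factor is a cycle, so
    -- its torsion part is zero.
    by_cases hp : p + 1 = p₁
    · subst hp
      obtain rfl : q' = q₁ := by omega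
      rw [S.comp_cat, map_neg, map_smul, TensorProduct.map_map, toBdry_comp_iCyc,
        TensorProduct.map_zero_right]
      simp
    · rw [S.comp_cat_of_ne _ _ hp]
      simp

/-- When the torsion parts vanish, a representing cycle can be changed by a boundary so that every
component is a cycle in both factors; such components lie in `Z ⊗ Z`. -/
theorem exists_sum_cross_eq [FiniteTorsionFree C] [FiniteTorsionFree D] (r : ℤ) (z : T.homology r)
    (hz : ∀ x : Idx r, S.torPart x.1.1 x.1.2 (x.1.2 - 1) r (sub_add_cancel _ 1) x.add_one z = 0) :
    ∃ t : ∀ x : Idx r, C.homology x.1.1 ⊗[R] D.homology x.1.2,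
      ∑ x, S.cross x.1.1 x.1.2 r x.add_one (t x) = z := by
  obtain ⟨c, rfl⟩ := πHom_surjective (K := T) r z
  -- Vanishing modulo boundaries of `C` means that the right differential of the component is itself
  -- a left differential. Its primitive lies in `C_{p+1} ⊗ B_{q-1}` and lifts to `C_{p+1} ⊗ D_q`.
  have h₁ : ∀ x : Idx r, ∃ s : C.X (x.1.1 + 1) ⊗[R] D.X x.1.2,
      TensorProduct.map (dLin C (x.1.1 + 1) x.1.1) (toBdry D (sub_add_cancel x.1.2 1)) s =
        TensorProduct.map LinearMap.id (toBdry D (sub_add_cancel x.1.2 1))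
          (S.comp x.1.1 x.1.2 r x.add_one (iCyc T r c)) := by
    intro x
    have h := congrArg (torEmb C D _ _) (hz x)
    rw [torEmb_torPart, map_zero, torChain_apply] at h
    have h' : TensorProduct.map (pOp C x.1.1) LinearMap.id
        (TensorProduct.map LinearMap.id (toBdry D (sub_add_cancel x.1.2 1))
          (S.comp x.1.1 x.1.2 r x.add_one (iCyc T r c))) = 0 := by
      rw [TensorProduct.map_map]
      exact h
    obtain ⟨s, hs⟩ := (map_id_exact (M := bdry D (x.1.2 - 1))
      (exact_dLin_pOp (K := C) (p := x.1.1 + 1) rfl) (pOp_surjective _) _).1 h'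
    obtain ⟨s, rfl⟩ := TensorProduct.map_surjective (g := LinearMap.id (M := C.X (x.1.1 + 1)))
      Function.surjective_id (toBdry_surjective (K := D) (sub_add_cancel x.1.2 1)) s
    refine ⟨s, ?_⟩
    rw [← hs, TensorProduct.map_map]
    rfl
  choose s hs using h₁
  let w : T.X (r + 1) := ∑ x : Idx r, S.cat (x.1.1 + 1) x.1.2 (r + 1)
    (by have := x.add_one; omega) (s x)
  have hw : ∀ x : Idx r, S.comp (x.1.1 + 1) x.1.2 (r + 1) (by have := x.add_one; omega) w = s x := by
    intro y
    rw [map_sum, Finset.sum_eq_single y]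
    · exact S.comp_cat _ _
    · exact fun x _ hx => S.comp_cat_of_ne _ _ (fun e => Idx.fst_ne hx (by omega)) _
    · exact fun hy => (hy (Finset.mem_univ y)).elim
  let c' : T.cycles r := c - toCyc T (r + 1) r w
  have hc' : iCyc T r c' = iCyc T r c - dLin T (r + 1) r w := by
    rw [← iCyc_comp_toCyc]
    exact map_sub _ _ _
  -- Subtracting `∂w` removes the left differential of `s x`. The other contribution of `∂w` in this
  -- bidegree is a right differential, which `toBdry` annihilates.
  have h₂ : ∀ x : Idx r, TensorProduct.map LinearMap.id (toBdry D (sub_add_cancel x.1.2 1))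
      (S.comp x.1.1 x.1.2 r x.add_one (iCyc T r c')) = 0 := by
    intro x
    rw [hc', map_sub, map_sub, ← hs x, S.comp_d (p := x.1.1 + 1) (q := x.1.2 + 1) rfl rfl rfl, hw,
      map_add, map_smul, TensorProduct.map_map, TensorProduct.map_map, toBdry_comp_dLin,
      TensorProduct.map_zero_right, LinearMap.zero_apply, smul_zero, add_zero, LinearMap.id_comp,
      LinearMap.comp_id, sub_self]
  have h₃ : ∀ p q q' (h : p + q + 1 = r), q' + 1 = q →
      TensorProduct.map LinearMap.id (dLin D q q') (S.comp p q r h (iCyc T r c')) = 0 := by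
    intro p q q' h hq
    by_cases hpq : p < -1 ∨ q < -1
    · rw [S.comp_eq_zero h hpq, map_zero]
    · obtain rfl : q' = q - 1 := by omega
      have := congrArg (TensorProduct.map LinearMap.id (iCyc D (q - 1) ∘ₗ (bdry D (q - 1)).subtype))
        (h₂ ⟨(p, q), by omega, by omega, by omega⟩)
      rw [TensorProduct.map_map, map_zero, LinearMap.comp_assoc,
        iCyc_comp_subtype_comp_toBdry] at this
      exact this
  -- With all right differentials zero, the cycle relation forces the left differentials to vanish
  -- too. By flatness, `C_p ⊗ Z_q` and the kernel of the left differential meet in `Z_p ⊗ Z_q`.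
  have h₄ : ∀ x : Idx r, ∃ b : C.cycles x.1.1 ⊗[R] D.cycles x.1.2,
      TensorProduct.map (iCyc C x.1.1) (iCyc D x.1.2) b =
        S.comp x.1.1 x.1.2 r x.add_one (iCyc T r c') := by
    intro x
    obtain ⟨a, ha⟩ := (id_map_exact_of_flat (M := C.X x.1.1)
      (exact_iCyc_toBdry (K := D) (sub_add_cancel x.1.2 1)) _).1 (h₂ x)
    have h₅ := S.map_comp_d (sub_add_cancel x.1.1 1) (q' := x.1.2) rfl (sub_add_cancel r 1)
      (by have := x.add_one; omega) (dLin_iCyc T r (r - 1) c')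
    rw [h₃ _ _ _ _ rfl, smul_zero, neg_zero, ← ha, map_map_comm] at h₅
    have h₆ : TensorProduct.map (dLin C x.1.1 (x.1.1 - 1)) LinearMap.id a = 0 :=
      id_map_injective (M := C.X (x.1.1 - 1)) (iCyc_injective (K := D) x.1.2)
        (h₅.trans (map_zero _).symm)
    obtain ⟨b, rfl⟩ := (map_id_exact_of_flat (M := D.cycles x.1.2)
      (exact_iCyc_dLin (K := C) (sub_add_cancel x.1.1 1)) _).1 h₆
    refine ⟨b, ?_⟩
    rw [← ha, TensorProduct.map_map]
    rfl
  choose b hb using h₄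
  refine ⟨fun x => TensorProduct.map (πHom C _) (πHom D _) (b x), ?_⟩
  have h₇ : ∑ x : Idx r, S.crossCycles x.1.1 x.1.2 r x.add_one (b x) = c' := by
    apply iCyc_injective r
    rw [map_sum]
    simp only [iCyc_crossCycles, hb]
    exact S.sum_cat_comp _
  have h₈ : πHom T r (toCyc T (r + 1) r w) = 0 := LinearMap.congr_fun (πHom_comp_toCyc _ _) w
  simp only [cross_map_πHom]
  rw [← map_sum, h₇, map_sub, h₈, sub_zero]

end ShiftedTensor

/-! #### Naturality -/

namespace ShiftedTensor

variable {C D T C' D' T' : Cx R} (S : ShiftedTensor C D T) (S' : ShiftedTensor C' D' T')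
  (φ : C ⟶ C') (ψ : D ⟶ D') (θ : T ⟶ T')

/-- Compatibility of chain maps with the identifications with tensor products. -/
def Compatible : Prop :=
  ∀ (p q r : ℤ) (h : p + q + 1 = r) (t : C.X p ⊗[R] D.X q),
    (θ.f r).hom (S.cat p q r h t) =
      S'.cat p q r h (TensorProduct.map (φ.f p).hom (ψ.f q).hom t)

variable {S S' φ ψ θ}

theorem Compatible.cross (hS : Compatible S S' φ ψ θ) (p q r : ℤ) (h : p + q + 1 = r)
    (t : C.homology p ⊗[R] D.homology q) :
    (homologyMap θ r).hom (S.cross p q r h t) =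
      S'.cross p q r h (TensorProduct.map (homologyMap φ p).hom (homologyMap ψ q).hom t) := by
  obtain ⟨z, rfl⟩ := TensorProduct.map_surjective (πHom_surjective (K := C) p)
    (πHom_surjective (K := D) q) t
  have hπ : ∀ {K L : Cx R} (f : K ⟶ L) (n : ℤ),
      (homologyMap f n).hom ∘ₗ πHom K n = πHom L n ∘ₗ (cyclesMap f n).hom := fun f n =>
    congrArg ModuleCat.Hom.hom (homologyπ_naturality f n)
  have hi : ∀ {K L : Cx R} (f : K ⟶ L) (n : ℤ),
      iCyc L n ∘ₗ (cyclesMap f n).hom = (f.f n).hom ∘ₗ iCyc K n := fun f n =>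
    congrArg ModuleCat.Hom.hom (cyclesMap_i f n)
  rw [TensorProduct.map_map, hπ, hπ, ← TensorProduct.map_map, cross_map_πHom, cross_map_πHom]
  refine (LinearMap.congr_fun (hπ θ r) _).trans (congrArg (πHom T' r) (iCyc_injective r ?_))
  refine (LinearMap.congr_fun (hi θ r) _).trans ?_
  rw [LinearMap.comp_apply, iCyc_crossCycles, iCyc_crossCycles, hS, TensorProduct.map_map,
    TensorProduct.map_map, hi, hi]

/-- Compatibility with inclusions passes to projections because every element is the sum of its
components. -/
theorem Compatible.comp (hS : Compatible S S' φ ψ θ) (x y : ℤ) (r : ℤ) (h : x + y + 1 = r) (v : T.X r) :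
    S'.comp x y r h ((θ.f r).hom v) =
      TensorProduct.map (φ.f x).hom (ψ.f y).hom (S.comp x y r h v) := by
  rw [← S.sum_cat_comp v]
  simp only [map_sum]
  refine Finset.sum_congr rfl fun i _ => ?_
  rw [hS]
  by_cases hi : i.1.1 = x
  · obtain ⟨⟨p, q⟩, hpq⟩ := i
    simp only at hi hpq ⊢
    subst hi
    obtain rfl : q = y := by omega
    rw [S.comp_cat, S'.comp_cat]
  · rw [S.comp_cat_of_ne _ _ hi, S'.comp_cat_of_ne _ _ hi, map_zero]

variable [IsDomain R] [IsPrincipalIdealRing R] [FiniteTorsionFree D] [FiniteTorsionFree D']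

/-- By injectivity of `torEmb` it suffices to compare chain-level formulas, whose ingredients are
all natural. -/
theorem Compatible.torPart (hS : Compatible S S' φ ψ θ) (p q q' r : ℤ) (hq : q' + 1 = q)
    (h : p + q + 1 = r) (z : T.homology r) :
    S'.torPart p q q' r hq h ((homologyMap θ r).hom z) =
      ((Tor (ModuleCat.{u} R) 1).obj (C'.homology p)).map (homologyMap ψ q')
        (((Tor (ModuleCat.{u} R) 1).map (homologyMap φ p)).app (D.homology q')
          (S.torPart p q q' r hq h z)) := by
  obtain ⟨c, rfl⟩ := πHom_surjective (K := T) r z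
  apply torEmb_injective C' D' p q'
  rw [torEmb_naturality, torEmb_torPart]
  have h₁ : (homologyMap θ r).hom (πHom T r c) = πHom T' r ((cyclesMap θ r).hom c) :=
    congrArg (fun f => f.hom c) (homologyπ_naturality θ r)
  have h₂ : iCyc T' r ((cyclesMap θ r).hom c) = (θ.f r).hom (iCyc T r c) :=
    congrArg (fun f => f.hom c) (cyclesMap_i θ r)
  have h₃ : pOp C' p ∘ₗ (φ.f p).hom = (opcyclesMap φ p).hom ∘ₗ pOp C p :=
    congrArg ModuleCat.Hom.hom (p_opcyclesMap φ p).symm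
  rw [h₁, torEmb_torPart, torChain_apply, torChain_apply, h₂, Compatible.comp hS,
    TensorProduct.map_map, TensorProduct.map_map, h₃, bdryMap_comp_toBdry]

end ShiftedTensor

end KunnethExact

/-! ### Concatenation of paths -/

section Concatenation

open TensorProduct

variable {R : Type u} [CommRing R] {V V' : Type u}

theorem path_hom_ext {M : Type*} [AddCommMonoid M] [Module R M] {f g : (List V →₀ R) →ₗ[R] M}
    (h : ∀ l, f (elem R l) = g (elem R l)) : f = g :=
  Finsupp.lhom_ext' fun l => LinearMap.ext_ring (h l)

theorem path_tensor_hom_ext {M : Type*} [AddCommMonoid M] [Module R M]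
    {f g : (List V →₀ R) ⊗[R] (List V' →₀ R) →ₗ[R] M}
    (h : ∀ a b, f (elem R a ⊗ₜ elem R b) = g (elem R a ⊗ₜ elem R b)) : f = g := by
  refine TensorProduct.ext ?_
  refine path_hom_ext fun a => path_hom_ext fun b => h a b

open scoped Classical in
/-- The projection of `Λ(V)` to the span of the elementary paths in `S`. -/
def keep (R : Type u) [CommRing R] (S : Set (List V)) : (List V →₀ R) →ₗ[R] (List V →₀ R) :=
  Finsupp.linearCombination R fun l => if l ∈ S then elem R l else 0

theorem keep_elem_of {S : Set (List V)} {l : List V} (h : l ∈ S) :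
    keep R S (elem R l) = elem R l := by
  simp [keep, elem, h]

theorem keep_elem_of_not {S : Set (List V)} {l : List V} (h : l ∉ S) :
    keep R S (elem R l) = 0 := by
  simp [keep, elem, h]

theorem regProj_eq_keep : regProj R V = keep R {l | l.IsChain (· ≠ ·)} := by
  refine path_hom_ext fun l => ?_
  by_cases h : l.IsChain (· ≠ ·)
  · rw [regProj_elem_of l h, keep_elem_of (by simpa using h)]
  · rw [regProj_elem_of_not l h, keep_elem_of_not (by simpa using h)]

theorem keep_comp_keep (S T : Set (List V)) : keep R S ∘ₗ keep R T = keep R (S ∩ T) := by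
  refine path_hom_ext fun l => ?_
  rw [LinearMap.comp_apply]
  by_cases hT : l ∈ T
  · rw [keep_elem_of hT]
    by_cases hS : l ∈ S
    · rw [keep_elem_of hS, keep_elem_of (Set.mem_inter hS hT)]
    · rw [keep_elem_of_not hS, keep_elem_of_not fun h => hS h.1]
  · rw [keep_elem_of_not hT, keep_elem_of_not fun h => hT h.2, map_zero]

theorem keep_empty : keep R (∅ : Set (List V)) = 0 :=
  path_hom_ext fun l => keep_elem_of_not (Set.notMem_empty l)

theorem mem_supported_iff_keep (S : Set (List V)) (x : List V →₀ R) :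
    x ∈ Finsupp.supported R R S ↔ keep R S x = x := by
  constructor
  · intro hx
    suffices h : Finsupp.supported R R S ≤ LinearMap.eqLocus (keep R S) LinearMap.id from h hx
    rw [Finsupp.supported_eq_span_single, Submodule.span_le]
    rintro _ ⟨l, hl, rfl⟩
    exact keep_elem_of hl
  · intro hx
    rw [← hx, keep, Finsupp.linearCombination_apply]
    refine Submodule.sum_mem _ fun l _ => Submodule.smul_mem _ _ ?_
    split_ifs with h
    · exact Finsupp.single_mem_supported R _ h
    · exact Submodule.zero_mem _

/-- The paths with `p + 1` vertices. -/
def ofDim (V : Type u) (p : ℤ) : Set (List V) := {l | (l.length : ℤ) = p + 1}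

/-- The sign `e_{i₀ … i_p} ↦ (-1)^(p+1) e_{i₀ … i_p}`. -/
def signMap (R : Type u) [CommRing R] (V : Type u) : (List V →₀ R) →ₗ[R] (List V →₀ R) :=
  Finsupp.linearCombination R fun l => (-1 : R) ^ l.length • elem R l

theorem signMap_elem (l : List V) : signMap R V (elem R l) = (-1 : R) ^ l.length • elem R l := by
  simp only [signMap, elem, Finsupp.linearCombination_single, one_smul]

theorem sgn_eq {p : ℤ} {n : ℕ} (h : (n : ℤ) = p + 1) : sgn R p = (-1) ^ n := by
  rw [sgn, ← h, Int.negOnePow_def]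
  simp

theorem signMap_comp_keep (p : ℤ) : signMap R V ∘ₗ keep R (ofDim V p) =
    sgn R p • keep R (ofDim V p) := by
  refine path_hom_ext fun l => ?_
  rw [LinearMap.comp_apply, LinearMap.smul_apply]
  by_cases h : l ∈ ofDim V p
  · rw [keep_elem_of h, signMap_elem, sgn_eq h]
  · rw [keep_elem_of_not h, map_zero, smul_zero]

theorem keep_comp_signMap (S : Set (List V)) :
    keep R S ∘ₗ signMap R V = signMap R V ∘ₗ keep R S := by
  refine path_hom_ext fun l => ?_
  rw [LinearMap.comp_apply, LinearMap.comp_apply, signMap_elem, map_smul]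
  by_cases h : l ∈ S
  · rw [keep_elem_of h, signMap_elem]
  · rw [keep_elem_of_not h, map_zero, smul_zero]

theorem regBoundary_comp_keep (w : V → R) {p q : ℤ} (hq : q + 1 = p) :
    regBoundary w ∘ₗ keep R (ofDim V p) = keep R (ofDim V q) ∘ₗ regBoundary w := by
  have h : boundary w ∘ₗ keep R (ofDim V p) = keep R (ofDim V q) ∘ₗ boundary w := by
    refine path_hom_ext fun l => ?_
    have hb : boundary w (elem R l) =
        ∑ k : Fin l.length, ((-1) ^ (k : ℕ) * w (l.get k)) • elem R (l.eraseIdx k) := by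
      simp only [boundary, elem, Finsupp.linearCombination_single, one_smul]
    rw [LinearMap.comp_apply, LinearMap.comp_apply, hb, map_sum]
    have hl : ∀ k : Fin l.length, l.eraseIdx k ∈ ofDim V q ↔ l ∈ ofDim V p := by
      intro k
      have h₁ := List.length_eraseIdx_of_lt k.2
      have h₂ := k.2
      simp only [ofDim, Set.mem_ofPred_eq, h₁]
      omega
    by_cases h : l ∈ ofDim V p
    · rw [keep_elem_of h, hb]
      refine Finset.sum_congr rfl fun k _ => ?_
      rw [map_smul, keep_elem_of ((hl k).2 h)]
    · rw [keep_elem_of_not h, map_zero]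
      refine (Finset.sum_eq_zero fun k _ => ?_).symm
      rw [map_smul, keep_elem_of_not fun hk => h ((hl k).1 hk), smul_zero]
  rw [regBoundary, LinearMap.comp_assoc, h, ← LinearMap.comp_assoc, ← LinearMap.comp_assoc,
    regProj_eq_keep, keep_comp_keep, keep_comp_keep, Set.inter_comm]

/-- Concatenation of a path on `V` and a path on `V'`. -/
def joinList (a : List V) (b : List V') : List (V ⊕ V') := a.map Sum.inl ++ b.map Sum.inr

/-- Concatenation of paths, as a linear map. -/
def catMap (R : Type u) [CommRing R] (V V' : Type u) :
    (List V →₀ R) ⊗[R] (List V' →₀ R) →ₗ[R] (List (V ⊕ V') →₀ R) :=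
  Finsupp.lmapDomain R R (fun x : List V × List V' => joinList x.1 x.2) ∘ₗ
    (finsuppTensorFinsupp' R (List V) (List V')).toLinearMap

theorem catMap_elem (a : List V) (b : List V') :
    catMap R V V' (elem R a ⊗ₜ elem R b) = elem R (joinList a b) := by
  simp [catMap, elem]

/-- The decomposition of a path on `V ⊔ V'` into its parts on `V` and on `V'`. -/
def splitMap (R : Type u) [CommRing R] (V V' : Type u) :
    (List (V ⊕ V') →₀ R) →ₗ[R] (List V →₀ R) ⊗[R] (List V' →₀ R) :=
  Finsupp.linearCombination R fun l =>
    elem R (l.filterMap Sum.getLeft?) ⊗ₜ elem R (l.filterMap Sum.getRight?)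

theorem splitMap_elem_joinList (a : List V) (b : List V') :
    splitMap R V V' (elem R (joinList a b)) = elem R a ⊗ₜ elem R b := by
  have h₁ : (joinList a b).filterMap Sum.getLeft? = a := by
    simp [joinList, List.filterMap_map, Function.comp_def]
  have h₂ : (joinList a b).filterMap Sum.getRight? = b := by
    simp [joinList, List.filterMap_map, Function.comp_def]
  simp only [splitMap, elem, Finsupp.linearCombination_single, one_smul]
  rw [h₁, h₂]

theorem splitMap_catMap (t : (List V →₀ R) ⊗[R] (List V' →₀ R)) :
    splitMap R V V' (catMap R V V' t) = t := by
  suffices h : splitMap R V V' ∘ₗ catMap R V V' = LinearMap.id from LinearMap.congr_fun h t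
  refine path_tensor_hom_ext fun a b => ?_
  rw [LinearMap.comp_apply, catMap_elem, splitMap_elem_joinList, LinearMap.id_apply]

theorem catMap_consMap (i : V) (x : List V →₀ R) (y : List V' →₀ R) :
    catMap R V V' (consMap R i x ⊗ₜ y) = consMap R (Sum.inl i) (catMap R V V' (x ⊗ₜ y)) := by
  suffices h : catMap R V V' ∘ₗ TensorProduct.map (consMap R i) LinearMap.id =
      consMap R (Sum.inl i) ∘ₗ catMap R V V' from LinearMap.congr_fun h (x ⊗ₜ y)
  refine path_tensor_hom_ext fun a b => ?_
  rw [LinearMap.comp_apply, LinearMap.comp_apply, TensorProduct.map_tmul, consMap_elem,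
    LinearMap.id_apply, catMap_elem, catMap_elem, consMap_elem]
  rfl

theorem catMap_nil (y : List V' →₀ R) :
    catMap R V V' (elem R [] ⊗ₜ y) = listMap R Sum.inr y := by
  suffices h : catMap R V V' ∘ₗ TensorProduct.mk R (List V →₀ R) (List V' →₀ R) (elem R []) =
      listMap R (Sum.inr : V' → V ⊕ V') from
    LinearMap.congr_fun h y
  refine path_hom_ext fun b => ?_
  rw [LinearMap.comp_apply, TensorProduct.mk_apply, catMap_elem, listMap_elem]
  rfl

/-- Leibniz rule, by induction on the first path: each prepended vertex contributes its own deletion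
term and changes the sign of the rest, which is what `signMap` records. -/
theorem boundary_catMap (w : V → R) (w' : V' → R) (t : (List V →₀ R) ⊗[R] (List V' →₀ R)) :
    boundary (Sum.elim w w') (catMap R V V' t) =
      catMap R V V' (TensorProduct.map (boundary w) LinearMap.id t +
        TensorProduct.map (signMap R V) (boundary w') t) := by
  suffices h : boundary (Sum.elim w w') ∘ₗ catMap R V V' =
      catMap R V V' ∘ₗ (TensorProduct.map (boundary w) LinearMap.id +
        TensorProduct.map (signMap R V) (boundary w')) from LinearMap.congr_fun h t
  refine path_tensor_hom_ext fun a b => ?_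
  rw [LinearMap.comp_apply, LinearMap.comp_apply, LinearMap.add_apply, TensorProduct.map_tmul,
    TensorProduct.map_tmul, LinearMap.id_apply, signMap_elem]
  induction a with
  | nil =>
    rw [boundary_nil, TensorProduct.zero_tmul, zero_add, List.length_nil, pow_zero, one_smul,
      catMap_nil, catMap_nil, listMap_boundary w' (Sum.elim w w') Sum.inr fun i => rfl]
  | cons i a ih =>
    rw [← consMap_elem, catMap_consMap, boundary_consMap, ih, boundary_consMap,
      TensorProduct.sub_tmul, map_add, map_add, map_add, map_sub, catMap_consMap,
      ← TensorProduct.smul_tmul', ← TensorProduct.smul_tmul', ← TensorProduct.smul_tmul',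
      map_smul, map_smul, map_smul, map_smul, catMap_consMap, List.length_cons, pow_succ,
      Sum.elim_inl, mul_neg_one, neg_smul]
    abel

/-- The one new adjacency goes from `V` to `V'`, where `h` imposes no condition. This covers both
allowed and regular paths. -/
theorem isChain_joinList {r : V ⊕ V' → V ⊕ V' → Prop} {s : V → V → Prop} {s' : V' → V' → Prop}
    (hs : ∀ i j, r (Sum.inl i) (Sum.inl j) ↔ s i j)
    (hs' : ∀ i j, r (Sum.inr i) (Sum.inr j) ↔ s' i j)
    (h : ∀ i j, r (Sum.inl i) (Sum.inr j)) (a : List V) (b : List V') :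
    (joinList a b).IsChain r ↔ a.IsChain s ∧ b.IsChain s' := by
  have h₁ : (a.map Sum.inl).IsChain r ↔ a.IsChain s := by
    rw [List.isChain_map]
    simp only [hs]
  have h₂ : (b.map Sum.inr).IsChain r ↔ b.IsChain s' := by
    rw [List.isChain_map]
    simp only [hs']
  rw [joinList, List.isChain_append, h₁, h₂]
  refine ⟨fun h => ⟨h.1, h.2.1⟩, fun h' => ⟨h'.1, h'.2, ?_⟩⟩
  intro x hx y hy
  obtain ⟨i, -, rfl⟩ := List.mem_map.1 (List.mem_of_mem_getLast? hx)
  obtain ⟨j, -, rfl⟩ := List.mem_map.1 (List.mem_of_mem_head? hy)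
  exact h i j

theorem keep_catMap {S : Set (List (V ⊕ V'))} {A : Set (List V)} {B : Set (List V')}
    (hS : ∀ a b, joinList a b ∈ S ↔ a ∈ A ∧ b ∈ B) (t : (List V →₀ R) ⊗[R] (List V' →₀ R)) :
    keep R S (catMap R V V' t) = catMap R V V' (TensorProduct.map (keep R A) (keep R B) t) := by
  suffices h : keep R S ∘ₗ catMap R V V' = catMap R V V' ∘ₗ TensorProduct.map (keep R A) (keep R B)
    from LinearMap.congr_fun h t
  refine path_tensor_hom_ext fun a b => ?_
  rw [LinearMap.comp_apply, LinearMap.comp_apply, TensorProduct.map_tmul, catMap_elem]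
  by_cases ha : a ∈ A
  · by_cases hb : b ∈ B
    · rw [keep_elem_of ha, keep_elem_of hb, catMap_elem, keep_elem_of ((hS a b).2 ⟨ha, hb⟩)]
    · rw [keep_elem_of_not hb, TensorProduct.tmul_zero, map_zero,
        keep_elem_of_not fun h => hb ((hS a b).1 h).2]
  · rw [keep_elem_of_not ha, TensorProduct.zero_tmul, map_zero,
      keep_elem_of_not fun h => ha ((hS a b).1 h).1]

/-- The one-sided form is needed for degrees: the length of a concatenation does not determine the
lengths of its two parts. -/
theorem keep_catMap_map_keep {S : Set (List (V ⊕ V'))} {A : Set (List V)} {B : Set (List V')}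
    (hS : ∀ a ∈ A, ∀ b ∈ B, joinList a b ∈ S) (t : (List V →₀ R) ⊗[R] (List V' →₀ R)) :
    keep R S (catMap R V V' (TensorProduct.map (keep R A) (keep R B) t)) =
      catMap R V V' (TensorProduct.map (keep R A) (keep R B) t) := by
  suffices h : keep R S ∘ₗ catMap R V V' ∘ₗ TensorProduct.map (keep R A) (keep R B) =
      catMap R V V' ∘ₗ TensorProduct.map (keep R A) (keep R B) from LinearMap.congr_fun h t
  refine path_tensor_hom_ext fun a b => ?_
  rw [LinearMap.comp_apply, LinearMap.comp_apply, TensorProduct.map_tmul]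
  by_cases ha : a ∈ A
  · by_cases hb : b ∈ B
    · rw [keep_elem_of ha, keep_elem_of hb, catMap_elem, keep_elem_of (hS a ha b hb)]
    · rw [keep_elem_of_not hb, TensorProduct.tmul_zero, map_zero, map_zero]
  · rw [keep_elem_of_not ha, TensorProduct.zero_tmul, map_zero, map_zero]

theorem regProj_catMap (t : (List V →₀ R) ⊗[R] (List V' →₀ R)) :
    regProj R (V ⊕ V') (catMap R V V' t) =
      catMap R V V' (TensorProduct.map (regProj R V) (regProj R V') t) := by
  rw [regProj_eq_keep, regProj_eq_keep, regProj_eq_keep]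
  exact keep_catMap (fun a b => isChain_joinList (by simp) (by simp) (by simp) a b) t

theorem regBoundary_catMap (w : V → R) (w' : V' → R) (t : (List V →₀ R) ⊗[R] (List V' →₀ R)) :
    regBoundary (Sum.elim w w') (catMap R V V' t) =
      catMap R V V' (TensorProduct.map (regBoundary w) (regProj R V') t +
        TensorProduct.map (signMap R V ∘ₗ regProj R V) (regBoundary w') t) := by
  have h : regProj R V ∘ₗ signMap R V = signMap R V ∘ₗ regProj R V := by
    rw [regProj_eq_keep, keep_comp_signMap]
  rw [regBoundary, LinearMap.comp_apply, boundary_catMap, regProj_catMap, map_add,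
    TensorProduct.map_map, TensorProduct.map_map, LinearMap.comp_id, h]
  rfl

theorem push_catMap {W W' : Type u} (f : V → W) (f' : V' → W')
    (t : (List V →₀ R) ⊗[R] (List V' →₀ R)) :
    push R (Sum.map f f') (catMap R V V' t) =
      catMap R W W' (TensorProduct.map (push R f) (push R f') t) := by
  have h : listMap R (Sum.map f f') (catMap R V V' t) =
      catMap R W W' (TensorProduct.map (listMap R f) (listMap R f') t) := by
    suffices h : listMap R (Sum.map f f') ∘ₗ catMap R V V' =
        catMap R W W' ∘ₗ TensorProduct.map (listMap R f) (listMap R f') from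
      LinearMap.congr_fun h t
    refine path_tensor_hom_ext fun a b => ?_
    rw [LinearMap.comp_apply, LinearMap.comp_apply, TensorProduct.map_tmul, catMap_elem,
      listMap_elem, listMap_elem, listMap_elem, catMap_elem]
    simp [joinList, Function.comp_def]
  rw [push, LinearMap.comp_apply, h, regProj_catMap, TensorProduct.map_map]
  rfl

end Concatenation

/-! ### The invariant paths of a join -/

section Join

open TensorProduct

variable {R : Type u} [CommRing R] (G G' : WeightedDigraph R)

/-- The inclusion of `Ω_p(G)` into the module of all paths. -/
def inclOmega (p : ℤ) : (omegaComplex G).X p →ₗ[R] (List G.V →₀ R) := (omega G p).subtype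

theorem inclOmega_injective (p : ℤ) : Function.Injective (inclOmega G p) :=
  (omega G p).injective_subtype

theorem inclOmega_mem (p : ℤ) (x : (omegaComplex G).X p) : inclOmega G p x ∈ omega G p :=
  Subtype.property (p := (· ∈ omega G p)) x

theorem exists_inclOmega_eq {p : ℤ} {v : List G.V →₀ R} (hv : v ∈ omega G p) :
    ∃ x, inclOmega G p x = v :=
  ⟨(⟨v, hv⟩ : omega G p), rfl⟩

theorem inclOmega_comp_dLin {p q : ℤ} (h : q + 1 = p) :
    inclOmega G q ∘ₗ dLin (omegaComplex G) p q = regBoundary G.weight ∘ₗ inclOmega G p := by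
  have hd : (omegaComplex G).d p q =
      ModuleCat.ofHom ((regBoundary G.weight).restrict (regBoundary_mem_omega G h)) := dif_pos h
  rw [dLin, hd]
  rfl

theorem inclOmega_omegaFunctor_map {G G' : WeightedDigraph R} (f : G ⟶ G') (p : ℤ) :
    inclOmega G' p ∘ₗ (((omegaFunctor R).map f).f p).hom = push R f.toFun ∘ₗ inclOmega G p :=
  rfl

/-- The set of allowed paths. -/
def allowedPaths : Set (List G.V) := {l | l.IsChain G.graph.Adj}

theorem allowed_eq (p : ℤ) :
    allowed G p = Finsupp.supported R R (ofDim G.V p ∩ allowedPaths G) :=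
  rfl

theorem keep_comp_inclOmega (p : ℤ) :
    keep R (ofDim G.V p ∩ allowedPaths G) ∘ₗ inclOmega G p = inclOmega G p := by
  refine LinearMap.ext fun x => ?_
  have h := ((mem_omega G p _).1 (inclOmega_mem G p x)).1
  rw [allowed_eq, mem_supported_iff_keep] at h
  exact h

theorem keep_ofDim_comp_inclOmega (p : ℤ) :
    keep R (ofDim G.V p) ∘ₗ inclOmega G p = inclOmega G p := by
  conv_lhs => rw [← keep_comp_inclOmega]
  rw [← LinearMap.comp_assoc, keep_comp_keep, ← Set.inter_assoc, Set.inter_self,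
    keep_comp_inclOmega]

theorem keep_ofDim_comp_inclOmega_of_ne {p q : ℤ} (h : p ≠ q) :
    keep R (ofDim G.V q) ∘ₗ inclOmega G p = 0 := by
  have : ofDim G.V q ∩ ofDim G.V p = ∅ := by
    refine Set.eq_empty_iff_forall_notMem.2 fun l hl => h ?_
    have h₁ : (l.length : ℤ) = q + 1 := hl.1
    have h₂ : (l.length : ℤ) = p + 1 := hl.2
    omega
  rw [← keep_ofDim_comp_inclOmega, ← LinearMap.comp_assoc, keep_comp_keep, this, keep_empty,
    LinearMap.zero_comp]

theorem regProj_comp_keep_allowed :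
    regProj R G.V ∘ₗ keep R (allowedPaths G) = keep R (allowedPaths G) := by
  have : {l : List G.V | l.IsChain (· ≠ ·)} ∩ allowedPaths G = allowedPaths G := by
    refine Set.inter_eq_right.2 fun l hl => ?_
    exact List.IsChain.imp (fun a b hab e => G.loopless a (by rwa [← e] at hab)) hl
  rw [regProj_eq_keep, keep_comp_keep, this]

theorem regProj_comp_inclOmega (p : ℤ) : regProj R G.V ∘ₗ inclOmega G p = inclOmega G p :=
  LinearMap.ext fun x =>
    regProj_of_mem_allowed G _ ((mem_omega G p _).1 (inclOmega_mem G p x)).1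

theorem signMap_comp_inclOmega (p : ℤ) :
    signMap R G.V ∘ₗ inclOmega G p = sgn R p • inclOmega G p := by
  rw [← keep_ofDim_comp_inclOmega, ← LinearMap.comp_assoc, signMap_comp_keep,
    LinearMap.smul_comp]

theorem omegaComplex_subsingleton (p : ℤ) (hp : p < -1) : Subsingleton ((omegaComplex G).X p) := by
  refine ⟨fun x y => inclOmega_injective G p ?_⟩
  have : ofDim G.V p = ∅ := by
    refine Set.eq_empty_iff_forall_notMem.2 fun l hl => ?_
    have h₁ : (l.length : ℤ) = p + 1 := hl
    omega
  rw [← keep_ofDim_comp_inclOmega, this, keep_empty]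
  rfl

/-- A finite vertex set has finitely many paths of given length, and submodules of finite free
modules over a principal ideal domain are finite and torsion-free. -/
instance [IsDomain R] [IsPrincipalIdealRing R] : FiniteTorsionFree (omegaComplex G) where
  finite p := by
    have := G.finite
    have hS : (ofDim G.V p).Finite := by
      refine (List.finite_length_eq G.V (p + 1).toNat).subset fun l hl => ?_
      have h₁ : (l.length : ℤ) = p + 1 := hl
      change l.length = _
      omega
    have := hS.to_subtype
    let f : (omegaComplex G).X p →ₗ[R] Finsupp.supported R R (ofDim G.V p) :=
      (inclOmega G p).codRestrict _ fun x => by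
        rw [mem_supported_iff_keep]
        exact LinearMap.congr_fun (keep_ofDim_comp_inclOmega G p) x
    have hf : Function.Injective f := fun x y h => by
      have h' := congrArg Subtype.val h
      exact inclOmega_injective G p h'
    let e := Finsupp.supportedEquivFinsupp (M := R) (R := R) (ofDim G.V p)
    exact Module.Finite.of_injective (e.toLinearMap ∘ₗ f) (e.injective.comp hf)
  torsionFree p := (inclOmega_injective G p).moduleIsTorsionFree _ (map_smul _)

/-- The linear map on paths whose kernel is `Ω_p(G)`. -/
def omegaTest (p : ℤ) : (List G.V →₀ R) →ₗ[R] (List G.V →₀ R) × (List G.V →₀ R) :=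
  LinearMap.inl R _ _ ∘ₗ (LinearMap.id - keep R (ofDim G.V p ∩ allowedPaths G)) +
    LinearMap.inr R _ _ ∘ₗ (LinearMap.id - keep R (allowedPaths G)) ∘ₗ regBoundary G.weight

/-- Writing `Ω_p` as a kernel lets flatness apply. The second coordinate tests no length, since the
boundary of an element of degree `p` has degree `p - 1` anyway. -/
theorem exact_inclOmega_omegaTest (p : ℤ) :
    Function.Exact (inclOmega G p) (omegaTest G p) := by
  intro u
  have h : omegaTest G p u = 0 ↔ u ∈ omega G p := by
    have ht : omegaTest G p u = (u - keep R (ofDim G.V p ∩ allowedPaths G) u,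
        regBoundary G.weight u - keep R (allowedPaths G) (regBoundary G.weight u)) := by
      simp [omegaTest]
    rw [mem_omega, allowed_eq, allowed_eq, mem_supported_iff_keep, mem_supported_iff_keep, ht,
      Prod.mk_eq_zero, sub_eq_zero, sub_eq_zero, eq_comm (a := u)]
    refine and_congr_right fun hu => ?_
    have hu' : keep R (ofDim G.V p) u = u := by
      conv_lhs => rw [← hu]
      rw [← LinearMap.comp_apply, keep_comp_keep, ← Set.inter_assoc, Set.inter_self, hu]
    have hd : keep R (ofDim G.V (p - 1)) (regBoundary G.weight u) = regBoundary G.weight u := by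
      rw [← LinearMap.comp_apply, ← regBoundary_comp_keep _ (sub_add_cancel p 1),
        LinearMap.comp_apply, hu']
    rw [Set.inter_comm, ← keep_comp_keep, LinearMap.comp_apply, hd, eq_comm]
  rw [h]
  constructor
  · exact exists_inclOmega_eq G
  · rintro ⟨x, rfl⟩
    exact inclOmega_mem G p x

/-- The inclusion of `Ω_p(G) ⊗ Ω_q(G')` into the tensor product of all paths. -/
def inclTensor (p q : ℤ) : (omegaComplex G).X p ⊗[R] (omegaComplex G').X q →ₗ[R]
    (List G.V →₀ R) ⊗[R] (List G'.V →₀ R) :=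
  TensorProduct.map (inclOmega G p) (inclOmega G' q)

theorem inclTensor_injective [IsDomain R] [IsPrincipalIdealRing R] (p q : ℤ) :
    Function.Injective (inclTensor G G' p q) :=
  TensorProduct.map_injective_of_flat_flat _ _ (inclOmega_injective G p) (inclOmega_injective G' q)

theorem joinList_mem_allowedPaths {S : Type u} (G G' : WeightedDigraph S) (a : List G.V)
    (b : List G'.V) :
    joinList a b ∈ allowedPaths (join G G') ↔ a ∈ allowedPaths G ∧ b ∈ allowedPaths G' :=
  isChain_joinList (r := (join G G').graph.Adj) (fun _ _ => Iff.rfl) (fun _ _ => Iff.rfl)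
    (fun _ _ => trivial) a b

theorem joinList_mem_ofDim {V V' : Type u} {p q r : ℤ} (h : p + q + 1 = r) {a : List V}
    (ha : a ∈ ofDim V p) {b : List V'} (hb : b ∈ ofDim V' q) : joinList a b ∈ ofDim (V ⊕ V') r := by
  have h₁ : (a.length : ℤ) = p + 1 := ha
  have h₂ : (b.length : ℤ) = q + 1 := hb
  change ((joinList a b).length : ℤ) = r + 1
  rw [joinList, List.length_append, List.length_map, List.length_map]
  omega

theorem catMap_inclTensor_mem_allowed (p q r : ℤ) (h : p + q + 1 = r)
    (t : (omegaComplex G).X p ⊗[R] (omegaComplex G').X q) :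
    catMap R G.V G'.V (inclTensor G G' p q t) ∈ allowed (join G G') r := by
  refine (mem_supported_iff_keep (ofDim (G.V ⊕ G'.V) r ∩ allowedPaths (join G G')) _).2 ?_
  rw [inclTensor, ← keep_comp_inclOmega G,
    ← keep_comp_inclOmega G', ← TensorProduct.map_map]
  exact keep_catMap_map_keep (fun a ha b hb => Set.mem_inter (joinList_mem_ofDim h ha.1 hb.1)
    ((joinList_mem_allowedPaths G G' a b).2 ⟨ha.2, hb.2⟩)) _

theorem regBoundary_catMap_inclTensor {p p' q q' : ℤ} (hp : p' + 1 = p) (hq : q' + 1 = q)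
    (t : (omegaComplex G).X p ⊗[R] (omegaComplex G').X q) :
    regBoundary (join G G').weight (catMap R G.V G'.V (inclTensor G G' p q t)) =
      catMap R G.V G'.V (inclTensor G G' p' q
        (TensorProduct.map (dLin (omegaComplex G) p p') LinearMap.id t)) +
      sgn R p • catMap R G.V G'.V (inclTensor G G' p q'
        (TensorProduct.map LinearMap.id (dLin (omegaComplex G') q q') t)) := by
  refine (regBoundary_catMap G.weight G'.weight _).trans ?_
  rw [inclTensor, inclTensor, inclTensor, TensorProduct.map_map, TensorProduct.map_map,
    TensorProduct.map_map, TensorProduct.map_map, LinearMap.comp_assoc, regProj_comp_inclOmega,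
    regProj_comp_inclOmega, signMap_comp_inclOmega, inclOmega_comp_dLin G hp,
    inclOmega_comp_dLin G' hq, TensorProduct.map_smul_left, map_add, LinearMap.smul_apply, map_smul]
  rfl

theorem catMap_inclTensor_mem (p q r : ℤ) (h : p + q + 1 = r)
    (t : (omegaComplex G).X p ⊗[R] (omegaComplex G').X q) :
    catMap R G.V G'.V (inclTensor G G' p q t) ∈ omega (join G G') r := by
  refine (mem_omega (join G G') r _).2 ⟨catMap_inclTensor_mem_allowed G G' p q r h t, ?_⟩
  rw [regBoundary_catMap_inclTensor G G' (sub_add_cancel p 1) (sub_add_cancel q 1)]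
  exact Submodule.add_mem _ (catMap_inclTensor_mem_allowed G G' _ _ _ (by omega) _)
    (Submodule.smul_mem _ _ (catMap_inclTensor_mem_allowed G G' _ _ _ (by omega) _))

/-- An allowed path that has entered `G'` cannot return to `G`. -/
theorem exists_joinList_eq {S : Type u} (G G' : WeightedDigraph S) (l : List (G.V ⊕ G'.V))
    (hl : l ∈ allowedPaths (join G G')) :
    ∃ a b, joinList a b = l := by
  induction l with
  | nil => exact ⟨[], [], rfl⟩
  | cons x l ih =>
    have hl : (x :: l).IsChain (join G G').graph.Adj := hl
    obtain ⟨a, b, rfl⟩ := ih hl.of_cons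
    rcases x with i | j
    · exact ⟨i :: a, b, rfl⟩
    · cases a with
      | nil => exact ⟨[], j :: b, rfl⟩
      | cons i a => exact (List.isChain_cons_cons.1 hl).1.elim

/-- Two linear maps which agree on allowed paths of a join agree on the span of these. -/
theorem eq_of_mem_allowed_join {M : Type*} [AddCommMonoid M] [Module R M]
    (f g : (List (G.V ⊕ G'.V) →₀ R) →ₗ[R] M) (r : ℤ)
    (h : ∀ a ∈ allowedPaths G, ∀ b ∈ allowedPaths G', ((a.length + b.length : ℕ) : ℤ) = r + 1 →
      f (elem R (joinList a b)) = g (elem R (joinList a b)))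
    (v : List (G.V ⊕ G'.V) →₀ R) (hv : v ∈ allowed (join G G') r) : f v = g v := by
  suffices hle : allowed (join G G') r ≤ LinearMap.eqLocus f g from hle hv
  rw [allowed, Finsupp.supported_eq_span_single]
  refine Submodule.span_le.2 ?_
  rintro _ ⟨l, ⟨hl, hc⟩, rfl⟩
  obtain ⟨a, b, rfl⟩ := exists_joinList_eq G G' l hc
  obtain ⟨ha, hb⟩ := (joinList_mem_allowedPaths G G' a b).1 hc
  refine h a ha b hb ?_
  have hlen : (joinList a b).length = a.length + b.length := by simp [joinList]
  rw [← hlen]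
  exact hl

/-- Allowedness is essential: `splitMap` forgets how the vertices of the two sides are interleaved.
-/
theorem catMap_splitMap (r : ℤ) (v : List (G.V ⊕ G'.V) →₀ R) (hv : v ∈ allowed (join G G') r) :
    catMap R G.V G'.V (splitMap R G.V G'.V v) = v := by
  refine eq_of_mem_allowed_join G G' (catMap R G.V G'.V ∘ₗ splitMap R G.V G'.V) LinearMap.id r
    (fun a _ b _ _ => ?_) v hv
  rw [LinearMap.comp_apply, splitMap_elem_joinList, catMap_elem, LinearMap.id_apply]

theorem map_keep_splitMap (r : ℤ) (v : List (G.V ⊕ G'.V) →₀ R) (hv : v ∈ allowed (join G G') r) :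
    TensorProduct.map (keep R (allowedPaths G)) (keep R (allowedPaths G'))
      (splitMap R G.V G'.V v) = splitMap R G.V G'.V v := by
  refine eq_of_mem_allowed_join G G'
    (TensorProduct.map (keep R (allowedPaths G)) (keep R (allowedPaths G')) ∘ₗ splitMap R G.V G'.V)
    (splitMap R G.V G'.V) r (fun a ha b hb _ => ?_) v hv
  rw [LinearMap.comp_apply, splitMap_elem_joinList, TensorProduct.map_tmul, keep_elem_of ha,
    keep_elem_of hb]

theorem sum_map_keep_splitMap (r : ℤ) (v : List (G.V ⊕ G'.V) →₀ R)
    (hv : v ∈ allowed (join G G') r) :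
    ∑ x : Idx r, TensorProduct.map (keep R (ofDim G.V x.1.1)) (keep R (ofDim G'.V x.1.2))
      (splitMap R G.V G'.V v) = splitMap R G.V G'.V v := by
  have h := eq_of_mem_allowed_join G G'
    ((∑ x : Idx r, TensorProduct.map (keep R (ofDim G.V x.1.1)) (keep R (ofDim G'.V x.1.2))) ∘ₗ
      splitMap R G.V G'.V) (splitMap R G.V G'.V) r (fun a ha b hb hab => ?_) v hv
  · rwa [LinearMap.comp_apply, LinearMap.sum_apply] at h
  rw [LinearMap.comp_apply, splitMap_elem_joinList, LinearMap.sum_apply]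
  push_cast at hab
  rw [Finset.sum_eq_single ⟨((a.length : ℤ) - 1, (b.length : ℤ) - 1), by omega, by omega, by omega⟩]
  · rw [TensorProduct.map_tmul, keep_elem_of, keep_elem_of]
    · exact (sub_add_cancel _ _).symm
    · exact (sub_add_cancel _ _).symm
  · intro x _ hx
    rw [TensorProduct.map_tmul, keep_elem_of_not, TensorProduct.zero_tmul]
    intro ha'
    have ha' : (a.length : ℤ) = x.1.1 + 1 := ha'
    refine Idx.fst_ne hx ?_
    simp only
    omega
  · exact fun h => (h (Finset.mem_univ _)).elim

/-- Both halves of an allowed path are allowed, hence regular, so the projections in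
`regBoundary_catMap` act trivially. -/
theorem splitMap_regBoundary (r : ℤ) (v : List (G.V ⊕ G'.V) →₀ R)
    (hv : v ∈ allowed (join G G') r) :
    splitMap R G.V G'.V (regBoundary (join G G').weight v) =
      TensorProduct.map (regBoundary G.weight) LinearMap.id (splitMap R G.V G'.V v) +
        TensorProduct.map (signMap R G.V) (regBoundary G'.weight) (splitMap R G.V G'.V v) := by
  conv_lhs => rw [← catMap_splitMap G G' r v hv]
  refine (congrArg (splitMap R G.V G'.V) (regBoundary_catMap G.weight G'.weight _)).trans ?_
  rw [splitMap_catMap, ← map_keep_splitMap G G' r v hv]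
  simp only [TensorProduct.map_map, LinearMap.comp_assoc, regProj_comp_keep_allowed,
    LinearMap.id_comp]

/-- The projection to the span of the paths which are not allowed. -/
def dropAllowed : (List G.V →₀ R) →ₗ[R] (List G.V →₀ R) :=
  LinearMap.id - keep R (allowedPaths G)

theorem dropAllowed_comp_keep : dropAllowed (R := R) G ∘ₗ keep R (allowedPaths G) = 0 := by
  rw [dropAllowed, LinearMap.sub_comp, keep_comp_keep, Set.inter_self, LinearMap.id_comp]
  exact sub_self (keep R (allowedPaths G))

theorem dropAllowed_comp_keep_ofDim (p : ℤ) : dropAllowed (R := R) G ∘ₗ keep R (ofDim G.V p) =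
    keep R (ofDim G.V p) ∘ₗ dropAllowed G := by
  rw [dropAllowed, LinearMap.sub_comp, LinearMap.comp_sub, keep_comp_keep, keep_comp_keep,
    Set.inter_comm, LinearMap.id_comp, LinearMap.comp_id]

theorem dropAllowed_comp_signMap_comp_keep :
    dropAllowed G ∘ₗ signMap R G.V ∘ₗ keep R (allowedPaths G) = 0 := by
  rw [← keep_comp_signMap, ← LinearMap.comp_assoc, dropAllowed_comp_keep, LinearMap.zero_comp]

theorem signMap_comp_signMap (V : Type u) : signMap R V ∘ₗ signMap R V = LinearMap.id := by
  refine path_hom_ext fun l => ?_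
  rw [LinearMap.comp_apply, signMap_elem, map_smul, signMap_elem, smul_smul, ← mul_pow]
  simp

/-- Here the two factors separate. Dropping allowed first halves kills `∂v`, which is allowed, and
also kills the second Leibniz term, whose first half is untouched up to sign. The first Leibniz term
must then vanish by itself. -/
theorem map_dropAllowed_left {r : ℤ} {v : List (G.V ⊕ G'.V) →₀ R} (hv : v ∈ omega (join G G') r) :
    TensorProduct.map (dropAllowed G ∘ₗ regBoundary G.weight) LinearMap.id
      (splitMap R G.V G'.V v) = 0 := by
  obtain ⟨hv, hv'⟩ := (mem_omega _ _ _).1 hv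
  have h := congrArg (TensorProduct.map (dropAllowed G) LinearMap.id)
    ((map_keep_splitMap G G' _ _ hv').trans (splitMap_regBoundary G G' r v hv))
  rw [map_add, TensorProduct.map_map, dropAllowed_comp_keep, TensorProduct.map_zero_left,
    LinearMap.zero_apply, TensorProduct.map_map, TensorProduct.map_map] at h
  rw [← map_keep_splitMap G G' r v hv, TensorProduct.map_map, TensorProduct.map_map,
    LinearMap.comp_assoc (f := keep R (allowedPaths G)) (g := signMap R G.V),
    dropAllowed_comp_signMap_comp_keep, TensorProduct.map_zero_left, LinearMap.zero_apply,
    add_zero, ← TensorProduct.map_map, map_keep_splitMap G G' r v hv] at h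
  exact h.symm

theorem map_dropAllowed_right {r : ℤ} {v : List (G.V ⊕ G'.V) →₀ R} (hv : v ∈ omega (join G G') r) :
    TensorProduct.map LinearMap.id (dropAllowed G' ∘ₗ regBoundary G'.weight)
      (splitMap R G.V G'.V v) = 0 := by
  obtain ⟨hv, hv'⟩ := (mem_omega _ _ _).1 hv
  -- Applying `signMap` on the left undoes the Leibniz sign, as `signMap` is an involution.
  have h := congrArg (TensorProduct.map (signMap R G.V) (dropAllowed G'))
    ((map_keep_splitMap G G' _ _ hv').trans (splitMap_regBoundary G G' r v hv))
  rw [map_add, TensorProduct.map_map, dropAllowed_comp_keep, TensorProduct.map_zero_right,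
    LinearMap.zero_apply, TensorProduct.map_map, TensorProduct.map_map, signMap_comp_signMap] at h
  have h₀ : TensorProduct.map (signMap R G.V ∘ₗ regBoundary G.weight)
      (dropAllowed G' ∘ₗ LinearMap.id) (splitMap R G.V G'.V v) = 0 := by
    rw [← map_keep_splitMap G G' r v hv, TensorProduct.map_map, LinearMap.comp_id,
      dropAllowed_comp_keep, TensorProduct.map_zero_right, LinearMap.zero_apply]
  rw [h₀, zero_add] at h
  exact h.symm

theorem omegaTest_comp_keep (p : ℤ) :
    omegaTest G p ∘ₗ keep R (ofDim G.V p) ∘ₗ keep R (allowedPaths G) =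
      LinearMap.inr R _ _ ∘ₗ keep R (ofDim G.V (p - 1)) ∘ₗ
        (dropAllowed G ∘ₗ regBoundary G.weight) ∘ₗ keep R (allowedPaths G) := by
  have h₁ : (LinearMap.id - keep R (ofDim G.V p ∩ allowedPaths G)) ∘ₗ
      keep R (ofDim G.V p) ∘ₗ keep R (allowedPaths G) = 0 := by
    rw [keep_comp_keep, LinearMap.sub_comp, keep_comp_keep, Set.inter_self, LinearMap.id_comp]
    exact sub_self (keep R (ofDim G.V p ∩ allowedPaths G))
  rw [omegaTest, LinearMap.add_comp, LinearMap.comp_assoc, h₁, LinearMap.comp_zero, zero_add,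
    ← dropAllowed, LinearMap.comp_assoc, LinearMap.comp_assoc, LinearMap.comp_assoc,
    ← LinearMap.comp_assoc _ _ (regBoundary G.weight),
    regBoundary_comp_keep _ (sub_add_cancel p 1), LinearMap.comp_assoc,
    ← LinearMap.comp_assoc _ _ (dropAllowed G), dropAllowed_comp_keep_ofDim, LinearMap.comp_assoc]

/-- The component is annihilated by the test map of either factor. Flatness of the path modules
places it in `Ω_p(G) ⊗ Λ(G'.V)`, and flatness of the target of the first test and of `Ω_p(G)` then
places it in `Ω_p(G) ⊗ Ω_q(G')`. -/
theorem splitMap_mem_range [IsDomain R] [IsPrincipalIdealRing R] (p q r : ℤ)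
    {v : List (G.V ⊕ G'.V) →₀ R} (hv : v ∈ omega (join G G') r) :
    TensorProduct.map (keep R (ofDim G.V p)) (keep R (ofDim G'.V q)) (splitMap R G.V G'.V v) ∈
      LinearMap.range (inclTensor G G' p q) := by
  have hk := map_keep_splitMap G G' r v ((mem_omega _ _ _).1 hv).1
  have hl : TensorProduct.map (omegaTest G p) LinearMap.id (TensorProduct.map
      (keep R (ofDim G.V p)) (keep R (ofDim G'.V q)) (splitMap R G.V G'.V v)) = 0 := by
    have h : TensorProduct.map (LinearMap.inr R (List G.V →₀ R) _ ∘ₗ keep R (ofDim G.V (p - 1)))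
        (keep R (ofDim G'.V q)) (TensorProduct.map (dropAllowed G ∘ₗ regBoundary G.weight)
          LinearMap.id (splitMap R G.V G'.V v)) = 0 := by
      rw [map_dropAllowed_left G G' hv, map_zero]
    -- Inserting the projections to allowed paths makes `omegaTest_comp_keep` applicable, which
    -- reduces the test to its boundary coordinate.
    rw [← hk, TensorProduct.map_map, TensorProduct.map_map] at h ⊢
    rw [LinearMap.comp_assoc, omegaTest_comp_keep]
    exact h
  have hr : TensorProduct.map LinearMap.id (omegaTest G' q) (TensorProduct.map
      (keep R (ofDim G.V p)) (keep R (ofDim G'.V q)) (splitMap R G.V G'.V v)) = 0 := by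
    have h : TensorProduct.map (keep R (ofDim G.V p)) (LinearMap.inr R (List G'.V →₀ R) _ ∘ₗ
        keep R (ofDim G'.V (q - 1))) (TensorProduct.map LinearMap.id
          (dropAllowed G' ∘ₗ regBoundary G'.weight) (splitMap R G.V G'.V v)) = 0 := by
      rw [map_dropAllowed_right G G' hv, map_zero]
    rw [← hk, TensorProduct.map_map, TensorProduct.map_map] at h ⊢
    rw [LinearMap.comp_assoc _ _ (omegaTest G' q), omegaTest_comp_keep]
    exact h
  obtain ⟨y, hy⟩ := (map_id_exact_of_flat (exact_inclOmega_omegaTest G p) _).1 hl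
  rw [← hy, ← map_map_comm] at hr
  have hr' : TensorProduct.map LinearMap.id (omegaTest G' q) y = 0 :=
    map_id_injective (inclOmega_injective G p) (hr.trans (map_zero _).symm)
  obtain ⟨z, rfl⟩ := (id_map_exact_of_flat (exact_inclOmega_omegaTest G' q) _).1 hr'
  refine ⟨z, ?_⟩
  rw [← hy, TensorProduct.map_map]
  rfl

end Join

/-! ### The complex of a join as a shifted tensor product. -/

section JoinTensor

open TensorProduct

variable {R : Type u} [CommRing R] (G G' : WeightedDigraph R)

/-- The inclusion of the invariant paths of a join into the module of all paths. -/
def inclJoin (r : ℤ) : (omegaComplex (join G G')).X r →ₗ[R] (List (G.V ⊕ G'.V) →₀ R) :=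
  inclOmega (join G G') r

theorem inclJoin_injective (r : ℤ) : Function.Injective (inclJoin G G' r) :=
  inclOmega_injective (join G G') r

theorem inclJoin_dLin {r r' : ℤ} (h : r' + 1 = r) (v : (omegaComplex (join G G')).X r) :
    inclJoin G G' r' (dLin (omegaComplex (join G G')) r r' v) =
      regBoundary (join G G').weight (inclJoin G G' r v) :=
  LinearMap.congr_fun (inclOmega_comp_dLin (join G G') h) v

theorem inclJoin_mem (r : ℤ) (v : (omegaComplex (join G G')).X r) :
    inclJoin G G' r v ∈ omega (join G G') r :=
  inclOmega_mem (join G G') r v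

/-- Concatenation of invariant paths. -/
def joinCat (p q r : ℤ) (h : p + q + 1 = r) :
    (omegaComplex G).X p ⊗[R] (omegaComplex G').X q →ₗ[R] (omegaComplex (join G G')).X r :=
  (catMap R G.V G'.V ∘ₗ inclTensor G G' p q).codRestrict (omega (join G G') r)
    (catMap_inclTensor_mem G G' p q r h)

theorem inclJoin_joinCat (p q r : ℤ) (h : p + q + 1 = r)
    (t : (omegaComplex G).X p ⊗[R] (omegaComplex G').X q) :
    inclJoin G G' r (joinCat G G' p q r h t) = catMap R G.V G'.V (inclTensor G G' p q t) :=
  rfl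

theorem inclTensor_map_left {p p' : ℤ} (hp : p' + 1 = p) (q : ℤ)
    (t : (omegaComplex G).X p ⊗[R] (omegaComplex G').X q) :
    inclTensor G G' p' q (TensorProduct.map (dLin (omegaComplex G) p p') LinearMap.id t) =
      TensorProduct.map (regBoundary G.weight) LinearMap.id (inclTensor G G' p q t) := by
  rw [inclTensor, inclTensor, TensorProduct.map_map, TensorProduct.map_map,
    inclOmega_comp_dLin G hp]
  rfl

theorem inclTensor_map_right (p : ℤ) {q q' : ℤ} (hq : q' + 1 = q)
    (t : (omegaComplex G).X p ⊗[R] (omegaComplex G').X q) :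
    inclTensor G G' p q' (TensorProduct.map LinearMap.id (dLin (omegaComplex G') q q') t) =
      TensorProduct.map LinearMap.id (regBoundary G'.weight) (inclTensor G G' p q t) := by
  rw [inclTensor, inclTensor, TensorProduct.map_map, TensorProduct.map_map,
    inclOmega_comp_dLin G' hq]
  rfl

variable [IsDomain R] [IsPrincipalIdealRing R]

/-- The part of bidegree `(p, q)` of an invariant path of a join. -/
def joinPart (p q r : ℤ) : (omegaComplex (join G G')).X r →ₗ[R]
    (List G.V →₀ R) ⊗[R] (List G'.V →₀ R) :=
  TensorProduct.map (keep R (ofDim G.V p)) (keep R (ofDim G'.V q)) ∘ₗ splitMap R G.V G'.V ∘ₗ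
    inclJoin G G' r

theorem joinPart_mem_range (p q r : ℤ) (v : (omegaComplex (join G G')).X r) :
    joinPart G G' p q r v ∈ LinearMap.range (inclTensor G G' p q) :=
  splitMap_mem_range G G' p q r (inclJoin_mem G G' r v)

/-- The components of an invariant path of a join. -/
def joinComp (p q r : ℤ) :
    (omegaComplex (join G G')).X r →ₗ[R] (omegaComplex G).X p ⊗[R] (omegaComplex G').X q :=
  (LinearEquiv.ofInjective (inclTensor G G' p q) (inclTensor_injective G G' p q)).symm.toLinearMap
    ∘ₗ (joinPart G G' p q r).codRestrict _ (joinPart_mem_range G G' p q r)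

theorem inclTensor_joinComp (p q r : ℤ) (v : (omegaComplex (join G G')).X r) :
    inclTensor G G' p q (joinComp G G' p q r v) =
      TensorProduct.map (keep R (ofDim G.V p)) (keep R (ofDim G'.V q))
        (splitMap R G.V G'.V (inclJoin G G' r v)) :=
  congrArg Subtype.val (LinearEquiv.apply_symm_apply (LinearEquiv.ofInjective
    (inclTensor G G' p q) (inclTensor_injective G G' p q))
    ((joinPart G G' p q r).codRestrict _ (joinPart_mem_range G G' p q r) v))

/-- The invariant paths of a join are the tensor products of invariant paths. -/
def joinTensor :
    ShiftedTensor (omegaComplex G) (omegaComplex G') (omegaComplex (join G G')) where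
  cat := joinCat G G'
  comp p q r _ := joinComp G G' p q r
  comp_cat {p q r} h t := by
    apply inclTensor_injective G G'
    rw [inclTensor_joinComp, inclJoin_joinCat, splitMap_catMap, inclTensor, TensorProduct.map_map,
      keep_ofDim_comp_inclOmega, keep_ofDim_comp_inclOmega]
  comp_cat_of_ne {p q p' q' r} h h' hne t := by
    apply inclTensor_injective G G'
    rw [inclTensor_joinComp, inclJoin_joinCat, splitMap_catMap, inclTensor, TensorProduct.map_map,
      keep_ofDim_comp_inclOmega_of_ne G hne, TensorProduct.map_zero_left, LinearMap.zero_apply,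
      map_zero]
  ext_zero {r} v hv := by
    apply inclJoin_injective G G'
    have hm := ((mem_omega _ _ _).1 (inclJoin_mem G G' r v)).1
    have h : splitMap R G.V G'.V (inclJoin G G' r v) = 0 := by
      refine (sum_map_keep_splitMap G G' r _ hm).symm.trans (Finset.sum_eq_zero fun x _ => ?_)
      rw [← inclTensor_joinComp, hv _ _ x.add_one, map_zero]
    refine (catMap_splitMap G G' r _ hm).symm.trans ?_
    rw [h, map_zero, map_zero]
  d_cat {p p' q q' r r'} hp hq hr h t := by
    apply inclJoin_injective G G'
    rw [map_add, map_smul, inclJoin_joinCat, inclJoin_joinCat, inclJoin_dLin G G' hr,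
      inclJoin_joinCat]
    exact regBoundary_catMap_inclTensor G G' hp hq t
  comp_d {p p' q q' r r'} hp hq hr h v := by
    apply inclTensor_injective G G'
    have hm := ((mem_omega _ _ _).1 (inclJoin_mem G G' r v)).1
    rw [inclTensor_joinComp, inclJoin_dLin G G' hr, map_add, map_smul,
      inclTensor_map_left G G' hp, inclTensor_map_right G G' _ hq, inclTensor_joinComp,
      inclTensor_joinComp, TensorProduct.map_map, TensorProduct.map_map,
      regBoundary_comp_keep _ hp, regBoundary_comp_keep _ hq]
    refine (congrArg _ (splitMap_regBoundary G G' r _ hm)).trans ?_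
    rw [map_add, TensorProduct.map_map, TensorProduct.map_map, keep_comp_signMap,
      signMap_comp_keep, TensorProduct.map_smul_left]
    rfl
  left_subsingleton := omegaComplex_subsingleton G
  right_subsingleton := omegaComplex_subsingleton G'

theorem joinTensor_compatible {G₁ G₁' : WeightedDigraph R} (f : G ⟶ G₁) (f' : G' ⟶ G₁') :
    (joinTensor G G').Compatible (joinTensor G₁ G₁') ((omegaFunctor R).map f)
      ((omegaFunctor R).map f')
      ((omegaFunctor R).map ((joinFunctor R).map (X := (G, G')) (Y := (G₁, G₁')) (f, f'))) := by
  intro p q r h t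
  apply inclJoin_injective G₁ G₁'
  have h₁ : inclJoin G₁ G₁' r ((((omegaFunctor R).map ((joinFunctor R).map (X := (G, G'))
      (Y := (G₁, G₁')) (f, f'))).f r).hom (joinCat G G' p q r h t)) =
      push R (Sum.map f.toFun f'.toFun) (catMap R G.V G'.V (inclTensor G G' p q t)) := rfl
  refine h₁.trans ?_
  rw [push_catMap, inclTensor, TensorProduct.map_map]
  refine Eq.trans ?_ (inclJoin_joinCat G₁ G₁' p q r h _).symm
  rw [inclTensor, TensorProduct.map_map, ← inclOmega_omegaFunctor_map,
    ← inclOmega_omegaFunctor_map]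
  rfl

end JoinTensor

/-! ### The exact sequence -/

section Sequence

open TensorProduct HomologicalComplex

variable {R : Type u} [CommRing R]

namespace ShiftedTensor

variable {C D T : Cx R} (S : ShiftedTensor C D T) (r : ℤ)

/-- The sum of the homology cross products. -/
def crossSum : DirectSum (Idx r) (fun x => C.homology x.1.1 ⊗[R] D.homology x.1.2) →ₗ[R]
    T.homology r :=
  DirectSum.toModule R (Idx r) _ fun x => S.cross x.1.1 x.1.2 r x.add_one

theorem crossSum_lof (x : Idx r) (t : C.homology x.1.1 ⊗[R] D.homology x.1.2) :
    S.crossSum r (DirectSum.lof R (Idx r) (fun x => C.homology x.1.1 ⊗[R] D.homology x.1.2) x t) =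
      S.cross x.1.1 x.1.2 r x.add_one t :=
  DirectSum.toModule_lof (M := fun x : Idx r => C.homology x.1.1 ⊗[R] D.homology x.1.2)
    (φ := fun x => S.cross x.1.1 x.1.2 r x.add_one) R x t

variable [IsDomain R] [IsPrincipalIdealRing R] [FiniteTorsionFree D]

/-- The projections to the torsion parts. -/
def torSum : T.homology r →ₗ[R] DirectSum (Idx r) (fun x => TorH C D x.1.1 (x.1.2 - 1)) :=
  ∑ x : Idx r, DirectSum.lof R (Idx r) (fun x => TorH C D x.1.1 (x.1.2 - 1)) x ∘ₗ
    S.torPart x.1.1 x.1.2 (x.1.2 - 1) r (sub_add_cancel _ 1) x.add_one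

theorem torSum_eq (z : T.homology r) :
    S.torSum r z = ∑ x : Idx r, DirectSum.lof R (Idx r) (fun x => TorH C D x.1.1 (x.1.2 - 1)) x
      (S.torPart x.1.1 x.1.2 (x.1.2 - 1) r (sub_add_cancel _ 1) x.add_one z) := by
  rw [torSum, LinearMap.sum_apply]
  rfl

theorem torSum_component (z : T.homology r) (y : Idx r) :
    DirectSum.component R (Idx r) (fun x => TorH C D x.1.1 (x.1.2 - 1)) y (S.torSum r z) =
      S.torPart y.1.1 y.1.2 (y.1.2 - 1) r (sub_add_cancel _ 1) y.add_one z := by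
  rw [torSum_eq, map_sum, Finset.sum_eq_single y]
  · exact DirectSum.component.lof_self ..
  · intro x _ hx
    rw [DirectSum.component.of, dif_neg hx]
  · exact fun h => (h (Finset.mem_univ y)).elim

theorem torSum_crossSum
    (t : DirectSum (Idx r) (fun x => C.homology x.1.1 ⊗[R] D.homology x.1.2)) :
    S.torSum r (S.crossSum r t) = 0 := by
  suffices h : S.torSum r ∘ₗ S.crossSum r = 0 from LinearMap.congr_fun h t
  refine DirectSum.linearMap_ext _ fun x => LinearMap.ext fun t => ?_
  rw [LinearMap.comp_apply, LinearMap.comp_apply, crossSum_lof, torSum_eq]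
  refine Finset.sum_eq_zero fun y _ => ?_
  rw [torPart_cross, map_zero]

theorem torSum_surjective : Function.Surjective (S.torSum r) := by
  intro t
  induction t using DirectSum.induction_on with
  | zero => exact ⟨0, map_zero _⟩
  | add t t' h h' =>
    obtain ⟨z, rfl⟩ := h
    obtain ⟨z', rfl⟩ := h'
    exact ⟨z + z', map_add _ _ _⟩
  | of x t =>
    obtain ⟨z, hz, hz'⟩ := S.exists_torPart_eq x.1.1 x.1.2 (x.1.2 - 1) r (sub_add_cancel _ 1)
      x.add_one t
    refine ⟨z, ?_⟩
    rw [torSum_eq, Finset.sum_eq_single x]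
    · rw [hz]
      rfl
    · intro y _ hy
      rw [hz' _ _ _ _ _ (Idx.fst_ne hy), map_zero]
    · exact fun h => (h (Finset.mem_univ x)).elim

variable [FiniteTorsionFree C]

theorem exists_crossSum_eq (z : T.homology r) (hz : S.torSum r z = 0) :
    ∃ t, S.crossSum r t = z := by
  obtain ⟨t, ht⟩ := S.exists_sum_cross_eq r z fun x => by
    rw [← torSum_component, hz, map_zero]
  refine ⟨∑ x, DirectSum.lof R (Idx r) (fun x => C.homology x.1.1 ⊗[R] D.homology x.1.2) x (t x), ?_⟩
  rw [map_sum, ← ht]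
  exact Finset.sum_congr rfl fun x _ => S.crossSum_lof r x (t x)

theorem exists_crossSum_retraction : ∃ ρ : T.homology r →ₗ[R]
    DirectSum (Idx r) (fun x => C.homology x.1.1 ⊗[R] D.homology x.1.2),
      ρ ∘ₗ S.crossSum r = LinearMap.id := by
  choose ρ hρ hρ' using fun x : Idx r => S.exists_retraction_cross x.1.1 x.1.2 r x.add_one
  refine ⟨∑ x : Idx r, DirectSum.lof R (Idx r) (fun x => C.homology x.1.1 ⊗[R] D.homology x.1.2) x
    ∘ₗ ρ x, DirectSum.linearMap_ext _ fun x => LinearMap.ext fun t => ?_⟩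
  rw [LinearMap.comp_apply, LinearMap.comp_apply, crossSum_lof, LinearMap.sum_apply,
    Finset.sum_eq_single x]
  · rw [LinearMap.comp_apply, hρ]
    rfl
  · intro y _ hy
    rw [LinearMap.comp_apply, hρ' y _ _ _ _ (Idx.fst_ne hy).symm, map_zero]
  · exact fun h => (h (Finset.mem_univ x)).elim

end ShiftedTensor

variable (R) [IsDomain R] [IsPrincipalIdealRing R] (r : ℤ)

/-- The cross product `⨁ H_p(G) ⊗ H_q(G') → H_r(G * G')` as a natural transformation. -/
def crossNatTrans : tensorTerm R r ⟶ joinTerm R r where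
  app P := ModuleCat.ofHom ((joinTensor P.1 P.2).crossSum r)
  naturality P Q f := by
    refine ModuleCat.hom_ext ?_
    refine DirectSum.linearMap_ext _ fun x => LinearMap.ext fun t => ?_
    have h₁ := (joinTensor_compatible P.1 P.2 f.1 f.2).cross x.1.1 x.1.2 r x.add_one t
    have h₂ := (joinTensor P.1 P.2).crossSum_lof r x t
    have h₃ := (joinTensor Q.1 Q.2).crossSum_lof r x
      (TensorProduct.map (homologyMap ((omegaFunctor R).map f.1) x.1.1).hom
        (homologyMap ((omegaFunctor R).map f.2) x.1.2).hom t)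
    refine Eq.trans (Eq.trans ?_ (h₃.trans h₁.symm)) (congrArg (homologyMap ((omegaFunctor R).map
      ((joinFunctor R).map f)) r).hom h₂.symm)
    exact congrArg ((joinTensor Q.1 Q.2).crossSum r) (DirectSum.lmap_lof _ _ _)

/-- The projection `H_r(G * G') → ⨁ Tor₁(H_p(G), H_{q-1}(G'))` as a natural transformation. -/
def torNatTrans : joinTerm R r ⟶ torTerm R r where
  app P := ModuleCat.ofHom ((joinTensor P.1 P.2).torSum r)
  naturality P Q f := by
    refine ModuleCat.hom_ext (LinearMap.ext fun z => ?_)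
    have h₁ := (joinTensor Q.1 Q.2).torSum_eq r
      ((homologyMap ((omegaFunctor R).map ((joinFunctor R).map f)) r).hom z)
    have h₂ := (joinTensor P.1 P.2).torSum_eq r z
    refine h₁.trans (Eq.trans ?_ (congrArg ((torTerm R r).map f).hom h₂.symm))
    refine Eq.trans (Finset.sum_congr rfl fun x _ => ?_) (map_sum ((torTerm R r).map f).hom _ _).symm
    refine Eq.trans (congrArg _ ((joinTensor_compatible P.1 P.2 f.1 f.2).torPart x.1.1 x.1.2
      (x.1.2 - 1) r (sub_add_cancel _ 1) x.add_one z)) ?_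
    exact (DirectSum.lmap_lof (fun x : Idx r => (((H R x.1.1).prod (H R (x.1.2 - 1)) ⋙
      Functor.uncurry.obj (Tor (ModuleCat.{u} R) 1)).map f).hom) x _).symm

end Sequence
end
end WPath

open WPath in
theorem theorem5p3 (R : Type u) [CommRing R] [IsDomain R] [IsPrincipalIdealRing R]
    (r : ℤ) (hr : 0 ≤ r) :
    ∃ (α : tensorTerm R r ⟶ joinTerm R r) (β : joinTerm R r ⟶ torTerm R r)
      (h : ∀ G G' : WeightedDigraph R, α.app (G, G') ≫ β.app (G, G') = 0),
      ∀ G G' : WeightedDigraph R,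
        (ShortComplex.mk (α.app (G, G')) (β.app (G, G')) (h G G')).ShortExact ∧
        Nonempty (ShortComplex.mk (α.app (G, G')) (β.app (G, G')) (h G G')).Splitting := by
  have h : ∀ G G' : WeightedDigraph R,
      (crossNatTrans R r).app (G, G') ≫ (torNatTrans R r).app (G, G') = 0 := fun G G' =>
    ModuleCat.hom_ext (LinearMap.ext ((joinTensor G G').torSum_crossSum r))
  refine ⟨crossNatTrans R r, torNatTrans R r, h, fun G G' => ?_⟩
  -- A splitting already implies short exactness; it is built from exactness in the middle, the
  -- retraction `ρ` and surjectivity of the projection to the torsion terms.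
  suffices hs : Nonempty (ShortComplex.mk _ _ (h G G')).Splitting from ⟨hs.some.shortExact, hs⟩
  obtain ⟨ρ, hρ⟩ := (joinTensor G G').exists_crossSum_retraction r
  refine ⟨.ofExactOfRetraction _ ?_ (ModuleCat.ofHom ρ) (ModuleCat.hom_ext hρ) ?_⟩
  · rw [ShortComplex.moduleCat_exact_iff]
    exact (joinTensor G G').exists_crossSum_eq r
  · rw [ModuleCat.epi_iff_surjective]
    exact (joinTensor G G').torSum_surjective r
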